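/- Let $G$ be a finite undirected graph (loops and multiple edges allowed) and let $f$ be a filtration function on $G$, that is, a real function on the vertices and edges with $f(v)\le f(e)$ whenever $v$ is an end of $e$. Let $a_0<\dots<a_n$ be the values of $f$, let $G_i=\{x : f(x)\le a_i\}$ with $G_{-1}=\emptyset$, and let $\operatorname{IC}_i$ be the closure of $G_i\setminus G_{i-1}$, that is, $G_i\setminus G_{i-1}$ together with all ends of its edges. Consider - the forward sequence $G_0\subset G_1\subset\dots\subset G_n=G$ (times $0,\dots,n$); - the backward sequence $G\to G/\operatorname{IC}_n\to G/(\operatorname{IC}_n\cup\operatorname{IC}_{n-1})\to\dots\to G/(\operatorname{IC}_n\cup\dots\cup\operatorname{IC}_0)=*$ (times $0,\dots,n+1$), where at each step the whole contracted part is collapsed to a single point; - the forward–backward (FB) sequence, the concatenation of the two, with $G_i$ at time $i$ for $0\le i\le n$ and the $j$-th contraction at time $n+j$ for $1\le j\le n+1$. The $k$-th persistence diagram of a sequence of graphs and maps is the multiset of pairs (birth time, death time) of the intervals in an interval decomposition of its $k$-th homology with coefficients in $\mathbb{Z}/2$; the death time is $\infty$ for classes that survive to the last term. (The decomposition exists,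 and the diagram does not depend on it.) **Theorem.** (1) The FB diagram determines the forward and the backward diagrams: there are maps $\Phi_n,\Psi_n$ $(n\ge 0)$ from diagrams to diagrams such that, for every finite graph $G$, every filtration function $f$ on $G$ with $n+1$ values and every $k\ge 0$, $\Phi_n$ takes the $k$-th FB diagram of $(G,f)$ to its $k$-th forward diagram and $\Psi_n$ takes it to its $k$-th backward diagram. (2) The converse fails: there are two finite simple graphs $G,H$ such that, for the degree filtration (a vertex has its degree as value, an edge the maximum of the values of its two ends), which takes the same set of values on $G$ and on $H$, the $k$-th forward diagrams of $G$ and $H$ coincide and their $k$-th backward diagrams coincide for every $k\ge 0$, but for some $k$ their $k$-th FB diagrams differ. Thus FB persistence is strictly more expressive than forward and backward persistence combined. -/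

import Mathlib

universe u

namespace GraphPersistence

open scoped Graph

/-! ### Persistence modules and persistence diagrams -/

/-- A sequence `M₀ → M₁ → M₂ → ⋯` of vector spaces over `ℤ/2` and linear maps.
A finite sequence `M₀ → ⋯ → M_N` is represented by a sequence that is stationary from `N` on,
so that a class that survives to `M_N` has death time `∞`. -/
structure PersistenceModule where
  space : ℕ → Type u
  [addCommGroup : ∀ i, AddCommGroup (space i)]
  [module : ∀ i, Module (ZMod 2) (space i)]
  map : ∀ i, space i →ₗ[ZMod 2] space (i + 1)

attribute [instance] PersistenceModule.addCommGroup PersistenceModule.module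

/-- A persistence diagram: a finite multiset of pairs (birth time, death time). -/
abbrev Diagram : Type := Multiset (ℕ × ℕ∞)

/-- A decomposition of `M` into finitely many interval modules, indexed by `ι`.
The summand `s` lives on the times `i` with `birth s ≤ i < death s`; there it is the line spanned
by `gen s i`. The structure maps carry generators to generators until the death time, where they
are sent to `0`; at every time the generators alive form a basis. -/
structure IntervalDecomposition (M : PersistenceModule.{u}) (ι : Type) where
  birth : ι → ℕ
  death : ι → ℕ∞
  birth_lt_death : ∀ s, (birth s : ℕ∞) < death s
  gen : ∀ (_ : ι) (i : ℕ), M.space i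
  linearIndependent : ∀ i : ℕ, LinearIndependent (ZMod 2)
    (fun s : {s : ι // birth s ≤ i ∧ (i : ℕ∞) < death s} => gen s.1 i)
  span_eq_top : ∀ i : ℕ, Submodule.span (ZMod 2)
    (Set.range (fun s : {s : ι // birth s ≤ i ∧ (i : ℕ∞) < death s} => gen s.1 i)) = ⊤
  map_gen : ∀ (s : ι) (i : ℕ), birth s ≤ i → ((i + 1 : ℕ) : ℕ∞) < death s →
    M.map i (gen s i) = gen s (i + 1)
  map_gen_last : ∀ (s : ι) (i : ℕ), birth s ≤ i → death s = ((i + 1 : ℕ) : ℕ∞) →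
    M.map i (gen s i) = 0

/-- The multiset of (birth, death) pairs of the summands of an interval decomposition. -/
def IntervalDecomposition.diagram {M : PersistenceModule.{u}} {ι : Type} [Fintype ι]
    (I : IntervalDecomposition M ι) : Diagram :=
  Finset.univ.val.map (fun s : ι => (I.birth s, I.death s))

/-- `D` is the persistence diagram of `M`: there is an interval decomposition of `M` with diagram
`D`, and every interval decomposition of `M` has diagram `D`. -/
def IsPersistenceDiagram (M : PersistenceModule.{u}) (D : Diagram) : Prop :=
  (∃ (ι : Type) (_ : Fintype ι) (I : IntervalDecomposition M ι), I.diagram = D) ∧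
    ∀ (ι : Type) [Fintype ι] (I : IntervalDecomposition M ι), I.diagram = D

/-! ### Homology of graphs with coefficients in `ℤ/2`

A graph (undirected, loops and multiple edges allowed) is a 1-dimensional cell complex; its
homology is that of the cellular chain complex `C₁ → C₀`. -/

section Homology

variable {α β : Type u}

open Classical in
/-- The boundary `x + y` of an edge with ends `x` and `y` (so `0` for a loop). -/
noncomputable def edgeBoundary (X : Graph α β) (e : β) : α →₀ ZMod 2 :=
  if h : ∃ x y, X.IsLink e x y then
    Finsupp.single h.choose 1 + Finsupp.single h.choose_spec.choose 1
  else 0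

theorem edgeBoundary_eq {X : Graph α β} {e : β} {x y : α} (h : X.IsLink e x y) :
    edgeBoundary X e = Finsupp.single x 1 + Finsupp.single y 1 := by
  have h' : ∃ x y, X.IsLink e x y := ⟨x, y, h⟩
  rw [edgeBoundary, dif_pos h']
  obtain hl := h'.choose_spec.choose_spec
  generalize h'.choose_spec.choose = b at hl ⊢
  generalize h'.choose = a at hl ⊢
  rcases hl.eq_and_eq_or_eq_and_eq h with ⟨rfl, rfl⟩ | ⟨rfl, rfl⟩
  · rfl
  · rw [add_comm]

/-- The boundary map from 1-chains to 0-chains. -/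
noncomputable def boundary (X : Graph α β) : (β →₀ ZMod 2) →ₗ[ZMod 2] (α →₀ ZMod 2) :=
  Finsupp.linearCombination (ZMod 2) (edgeBoundary X)

/-- The 0-chains of `X`: combinations of vertices of `X`. -/
noncomputable def chains₀ (X : Graph α β) : Submodule (ZMod 2) (α →₀ ZMod 2) :=
  Finsupp.supported (ZMod 2) (ZMod 2) V(X)

/-- The 1-chains of `X`: combinations of edges of `X`. -/
noncomputable def chains₁ (X : Graph α β) : Submodule (ZMod 2) (β →₀ ZMod 2) :=
  Finsupp.supported (ZMod 2) (ZMod 2) E(X)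

/-- The 0-boundaries of `X`, inside the 0-chains. -/
noncomputable def boundaries₀ (X : Graph α β) : Submodule (ZMod 2) (chains₀ X) :=
  ((chains₁ X).map (boundary X)).comap (chains₀ X).subtype

/-- `H₀(X; ℤ/2)`. -/
abbrev H₀ (X : Graph α β) : Type u := chains₀ X ⧸ boundaries₀ X

/-- The 1-cycles of `X`. -/
noncomputable def cycles₁ (X : Graph α β) : Submodule (ZMod 2) (β →₀ ZMod 2) :=
  chains₁ X ⊓ LinearMap.ker (boundary X)

/-- `H₁(X; ℤ/2)`: the 1-cycles, as there are no 2-cells. -/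
abbrev H₁ (X : Graph α β) : Type u := cycles₁ X

/-- A cellular map between graphs with vertices in `α` and edges in `β`: vertices go to vertices,
and each edge `e` of `X` either goes to the edge of `Y` with the same name `e`, or, if `e` is not
an edge of `Y`, is collapsed to a vertex. Inclusions and contractions are of this form. -/
structure CellMap (X Y : Graph α β) where
  onVert : α → α
  vert_mem : ∀ x ∈ V(X), onVert x ∈ V(Y)
  link : ∀ e x y, X.IsLink e x y →
    Y.IsLink e (onVert x) (onVert y) ∨ (e ∉ E(Y) ∧ onVert x = onVert y)

namespace CellMap

variable {X Y : Graph α β} (φ : CellMap X Y)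

/-- The induced map on 0-chains. -/
noncomputable def map₀ (φ : CellMap X Y) : (α →₀ ZMod 2) →ₗ[ZMod 2] (α →₀ ZMod 2) :=
  Finsupp.lmapDomain (ZMod 2) (ZMod 2) φ.onVert

open Classical in
/-- The induced map on 1-chains: edges that are collapsed go to `0`. -/
noncomputable def map₁ (_φ : CellMap X Y) : (β →₀ ZMod 2) →ₗ[ZMod 2] (β →₀ ZMod 2) :=
  Finsupp.linearCombination (ZMod 2)
    (fun e => if e ∈ E(Y) then Finsupp.single e (1 : ZMod 2) else 0)

theorem map₀_mem {c : α →₀ ZMod 2} (hc : c ∈ chains₀ X) : φ.map₀ c ∈ chains₀ Y := by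
  have h : chains₀ X ≤ (chains₀ Y).comap φ.map₀ := by
    rw [chains₀, Finsupp.supported_eq_span_single, Submodule.span_le]
    rintro _ ⟨x, hx, rfl⟩
    simpa [map₀, chains₀, Finsupp.lmapDomain_apply, Finsupp.mapDomain_single] using
      Finsupp.single_mem_supported (ZMod 2) (1 : ZMod 2) (φ.vert_mem x hx)
  exact h hc

theorem map₁_mem (c : β →₀ ZMod 2) : φ.map₁ c ∈ chains₁ Y := by
  classical
  rw [map₁, Finsupp.linearCombination_apply]
  refine Submodule.sum_mem _ fun e _ => Submodule.smul_mem _ _ ?_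
  by_cases he : e ∈ E(Y)
  · simpa [he, chains₁] using Finsupp.single_mem_supported (ZMod 2) (1 : ZMod 2) he
  · simp [he]

theorem boundary_map₁ {c : β →₀ ZMod 2} (hc : c ∈ chains₁ X) :
    boundary Y (φ.map₁ c) = φ.map₀ (boundary X c) := by
  classical
  have h : chains₁ X ≤
      LinearMap.eqLocus (boundary Y ∘ₗ φ.map₁) (φ.map₀ ∘ₗ boundary X) := by
    rw [chains₁, Finsupp.supported_eq_span_single, Submodule.span_le]
    rintro _ ⟨e, he, rfl⟩
    obtain ⟨x, y, hxy⟩ := X.exists_isLink_of_mem_edgeSet he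
    have hX : φ.map₀ (boundary X (Finsupp.single e 1)) =
        Finsupp.single (φ.onVert x) 1 + Finsupp.single (φ.onVert y) 1 := by
      simp [boundary, edgeBoundary_eq hxy, map₀, Finsupp.mapDomain_add,
        Finsupp.mapDomain_single]
    change boundary Y (φ.map₁ (Finsupp.single e 1)) = φ.map₀ (boundary X (Finsupp.single e 1))
    rw [hX]
    rcases φ.link e x y hxy with hY | ⟨heY, hφ⟩
    · simp [map₁, boundary, hY.edge_mem, edgeBoundary_eq hY]
    · rw [hφ, ← Finsupp.single_add]
      simp [map₁, heY, show (1 : ZMod 2) + 1 = 0 from rfl]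
  exact h hc

/-- The induced map `H₀(X) → H₀(Y)`. -/
noncomputable def onH₀ (φ : CellMap X Y) : H₀ X →ₗ[ZMod 2] H₀ Y :=
  (boundaries₀ X).mapQ (boundaries₀ Y) (φ.map₀.restrict fun _ hc => φ.map₀_mem hc) (by
    rintro ⟨c, hc⟩ ⟨b, hb, hbc⟩
    exact ⟨φ.map₁ b, φ.map₁_mem b, by
      rw [φ.boundary_map₁ hb, hbc]; rfl⟩)

/-- The induced map `H₁(X) → H₁(Y)`. -/
noncomputable def onH₁ (φ : CellMap X Y) : H₁ X →ₗ[ZMod 2] H₁ Y :=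
  φ.map₁.restrict fun c hc => ⟨φ.map₁_mem c, by
    have h0 : boundary X c = 0 := hc.2
    change boundary Y (φ.map₁ c) = 0
    rw [φ.boundary_map₁ hc.1, h0, map_zero]⟩

end CellMap

/-- A sequence of graphs and cellular maps `X₀ → X₁ → X₂ → ⋯`. -/
structure GraphSequence (α β : Type u) where
  graph : ℕ → Graph α β
  map : ∀ i, CellMap (graph i) (graph (i + 1))

/-- The `k`-th persistent homology `H_k(X₀) → H_k(X₁) → ⋯` of a sequence of graphs. It vanishes for
`k ≥ 2`, since graphs are 1-dimensional. -/
noncomputable def GraphSequence.persistentHomology (S : GraphSequence α β) :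
    ℕ → PersistenceModule.{u}
  | 0 =>
    { space := fun i => H₀ (S.graph i)
      addCommGroup := fun i => Submodule.Quotient.addCommGroup (boundaries₀ (S.graph i))
      module := fun i => Submodule.Quotient.module (boundaries₀ (S.graph i))
      map := fun i => (S.map i).onH₀ }
  | 1 =>
    { space := fun i => H₁ (S.graph i)
      map := fun i => (S.map i).onH₁ }
  | _ + 2 => { space := fun _ => PUnit, map := fun _ => 0 }

end Homology

/-! ### Filtrations of graphs -/

section Filtration

variable {α β : Type u}

/-- A filtration function on a graph: a real function on vertices and edges whose value at an edge
is at least its values at the ends. -/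
structure FiltrationFunction (G : Graph α β) where
  onVert : α → ℝ
  onEdge : β → ℝ
  le_of_inc : ∀ e x, G.Inc e x → onVert x ≤ onEdge e

/-- The degree of a vertex, loops counting twice. -/
noncomputable def degree (G : Graph α β) (x : α) : ℕ :=
  (G.incidenceSet x).ncard + (G.loopSet x).ncard

namespace FiltrationFunction

variable {G : Graph α β} (f : FiltrationFunction G)

/-- `f` is the degree filtration: the value at a vertex is its degree, and the value at an edge is
the maximum of the values at its ends. -/
def IsDegreeFiltration : Prop :=
  (∀ x ∈ V(G), f.onVert x = degree G x) ∧
    ∀ e x y, G.IsLink e x y → f.onEdge e = max (f.onVert x) (f.onVert y)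

/-- The set `{a₀ < a₁ < ⋯ < aₙ}` of values of `f` on the vertices and edges of `G`. -/
def values : Set ℝ := f.onVert '' V(G) ∪ f.onEdge '' E(G)

/-- The index `n` of the last step of the filtration `G₀ ⊂ ⋯ ⊂ Gₙ = G` (for `G` nonempty). -/
noncomputable def lastStep : ℕ := f.values.ncard - 1

/-- The index `i` of a value `t = aᵢ`: the number of values smaller than `t`. -/
noncomputable def step (t : ℝ) : ℕ := {s ∈ f.values | s < t}.ncard

/-- The subgraph `Gᵢ = {f ≤ aᵢ}` of `G`; it is `G` for `i ≥ n`. -/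
noncomputable def sublevel (i : ℕ) : Graph α β :=
  (G.induce {x ∈ V(G) | f.step (f.onVert x) ≤ i}).restrict {e | f.step (f.onEdge e) ≤ i}

/-- The edges of the intermediate complex `ICᵢ`, the closure of `Gᵢ - Gᵢ₋₁`. -/
def icEdges (i : ℕ) : Set β := {e ∈ E(G) | f.step (f.onEdge e) = i}

/-- The vertices of the intermediate complex `ICᵢ`: those of `Gᵢ - Gᵢ₋₁` and the ends of the edges
of `Gᵢ - Gᵢ₋₁`. -/
def icVerts (i : ℕ) : Set α :=
  {x ∈ V(G) | f.step (f.onVert x) = i} ∪ {x | ∃ e ∈ f.icEdges i, G.Inc e x}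

/-- The edges contracted in the first `j` contraction steps, which contract
`ICₙ, ICₙ₋₁, …, ICₙ₋ⱼ₊₁` in this order. -/
def contractedEdges (j : ℕ) : Set β := {e | ∃ i ≤ f.lastStep, f.lastStep < i + j ∧ e ∈ f.icEdges i}

/-- The vertices contracted in the first `j` contraction steps. -/
def contractedVerts (j : ℕ) : Set α :=
  {x | ∃ i ≤ f.lastStep, f.lastStep < i + j ∧ x ∈ f.icVerts i}

open Classical in
/-- The map on vertices that collapses the set `K` to the point `none`. -/
noncomputable def collapse (K : Set α) (x : α) : Option α := if x ∈ K then none else some x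

/-- The graph obtained from the subgraph `Gᵢ` by contracting to a single point `none` everything
that is contracted in the first `j` contraction steps: the contracted edges disappear and the
contracted vertices are identified. For `j = 0` this is `Gᵢ`; for `i ≥ n` it is the `j`-th term
`G / (ICₙ ∪ ⋯ ∪ ICₙ₋ⱼ₊₁)` of the sequence of contractions (contracting the complexes one after the
other to the same point, or their union at once, gives the same graph). -/
noncomputable def stage (i j : ℕ) : Graph (Option α) β :=
  ((f.sublevel i).deleteEdges (f.contractedEdges j)).map (collapse (f.contractedVerts j))

theorem contractedVerts_mono {j j' : ℕ} (h : j ≤ j') :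
    f.contractedVerts j ⊆ f.contractedVerts j' := by
  rintro x ⟨i, hi, hij, hx⟩
  exact ⟨i, hi, by omega, hx⟩

theorem contractedEdges_mono {j j' : ℕ} (h : j ≤ j') :
    f.contractedEdges j ⊆ f.contractedEdges j' := by
  rintro x ⟨i, hi, hij, hx⟩
  exact ⟨i, hi, by omega, hx⟩

theorem mem_contractedVerts_of_inc {j : ℕ} {e : β} {x : α} (he : e ∈ f.contractedEdges j)
    (h : G.Inc e x) : x ∈ f.contractedVerts j := by
  obtain ⟨i, hi, hij, hx⟩ := he
  exact ⟨i, hi, hij, Or.inr ⟨e, hx, h⟩⟩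

theorem bind_collapse {j j' : ℕ} (h : j ≤ j') (x : α) :
    (collapse (f.contractedVerts j) x).bind (collapse (f.contractedVerts j')) =
      collapse (f.contractedVerts j') x := by
  by_cases hx : x ∈ f.contractedVerts j
  · simp [collapse, hx, f.contractedVerts_mono h hx]
  · simp [collapse, hx]

theorem stage_isLink {i j : ℕ} {e : β} {a b : Option α} :
    (f.stage i j).IsLink e a b ↔ ∃ x y, G.IsLink e x y ∧
      f.step (f.onVert x) ≤ i ∧ f.step (f.onVert y) ≤ i ∧ f.step (f.onEdge e) ≤ i ∧
      e ∉ f.contractedEdges j ∧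
      collapse (f.contractedVerts j) x = a ∧ collapse (f.contractedVerts j) y = b := by
  simp only [stage, sublevel, Graph.map_isLink, Relation.Map, Graph.deleteEdges_isLink,
    Graph.restrict_isLink, Graph.induce_isLink, Set.mem_ofPred_eq]
  constructor
  · rintro ⟨x, y, h, rfl, rfl⟩
    exact ⟨x, y, by tauto⟩
  · rintro ⟨x, y, h, h1, h2, h3, h4, rfl, rfl⟩
    have := h.left_mem
    have := h.right_mem
    exact ⟨x, y, by tauto, rfl, rfl⟩

/-- The natural map between two stages: an inclusion in the first index, a quotient map in the
second. -/
noncomputable def stageMap {i i' j j' : ℕ} (hi : i ≤ i') (hj : j ≤ j') :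
    CellMap (f.stage i j) (f.stage i' j') where
  onVert a := a.bind (collapse (f.contractedVerts j'))
  vert_mem := by
    rintro _ ⟨x, hx, rfl⟩
    refine ⟨x, ?_, (f.bind_collapse hj x).symm⟩
    exact ⟨hx.1, hx.2.trans hi⟩
  link := by
    intro e a b hab
    obtain ⟨x, y, h, h1, h2, h3, h4, rfl, rfl⟩ := f.stage_isLink.1 hab
    rw [f.bind_collapse hj, f.bind_collapse hj]
    by_cases he : e ∈ f.contractedEdges j'
    · right
      refine ⟨fun hE => ?_, ?_⟩
      · obtain ⟨c, d, hcd⟩ := Graph.exists_isLink_of_mem_edgeSet hE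
        obtain ⟨_, _, -, -, -, -, hne, -⟩ := f.stage_isLink.1 hcd
        exact hne he
      · simp [collapse, f.mem_contractedVerts_of_inc he h.inc_left,
          f.mem_contractedVerts_of_inc he h.inc_right]
    · left
      exact f.stage_isLink.2 ⟨x, y, h, h1.trans hi, h2.trans hi, h3.trans hi, he, rfl, rfl⟩

/-- The filtration `G₀ ⊂ G₁ ⊂ ⋯ ⊂ Gₙ = G`. -/
noncomputable def forward : GraphSequence (Option α) β where
  graph i := f.stage i 0
  map i := f.stageMap (Nat.le_succ i) le_rfl

/-- The sequence of contractions `G → G/ICₙ → G/(* ∪ ICₙ₋₁) → ⋯ → *`, with `G` at time `0` and `*`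
at time `n + 1`. -/
noncomputable def backward : GraphSequence (Option α) β where
  graph j := f.stage f.lastStep j
  map j := f.stageMap le_rfl (Nat.le_succ j)

/-- The concatenation `G₀ ⊂ ⋯ ⊂ Gₙ = G → G/ICₙ → G/(* ∪ ICₙ₋₁) → ⋯ → *` of the two, with `Gᵢ` at
time `i` for `i ≤ n` and the `j`-th contraction at time `n + j`. For `i ≤ n` the number `i - n` of
contractions performed is `0` (truncated subtraction); for `i ≥ n` the subgraph is `G`. -/
noncomputable def forwardBackward : GraphSequence (Option α) β where
  graph i := f.stage i (i - f.lastStep)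
  map i := f.stageMap (Nat.le_succ i) (Nat.sub_le_sub_right (Nat.le_succ i) _)

end FiltrationFunction

end Filtration

end GraphPersistence

open GraphPersistence
open scoped Graph

/-! Everything reduces to ranks. In an interval decomposition the bars containing both `i` and `j`
give a basis of the image of `M_i → M_j`, so the number of bars born by time `i` and alive at time
`j` is the rank of that map (`IntervalDecomposition.countP_diagram`), and differences of these
numbers recover the diagram (`Diagram.eq_of_countP_eq`). Decompositions exist by a greedy choice of
generators, oldest first and, at equal birth, shortest-lived first
(`PersistenceModule.Generator.decomposition`).

All graphs involved are stages of a two-parameter grid: sublevel index `i`, number of contractions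
`j`. The forward, backward and FB sequences are monotone paths in this grid, and by functoriality a
rank along a path depends only on its two end stages (`FiltrationFunction.rank_pathSequence`). The
FB path is the forward path followed by the backward one. Hence FB ranks between times at most `n`
are forward ranks, FB ranks between times at least `n` are backward ranks, and restricting the bars
to either half gives part (1).

For part (2), both graphs have degrees 2, 3, 4 with the same levels. In each, the forward maps are
surjective on `H₀` and injective on `H₁`, and the backward maps are surjective on both. The ranks of
such modules are dimensions of single spaces; those of `H₀` agree, and those of `H₁` then agree by
the Euler characteristic (`IsBalanced`). The FB sequence composes an injection with a surjection, so
it also sees how the image of the first meets the kernel of the second. In both graphs the only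
cycle of `G₁` is a triangle, and contracting `IC₂ ∪ IC₁` leaves edge `0` as a loop. In the first
graph edge `0` lies on the triangle, whose class therefore survives; in the second it is a separate
component of `G₁`, and the rank is zero. -/

namespace GraphPersistence

/-! ### Composite structure maps and ranks -/

namespace PersistenceModule

variable (M : PersistenceModule.{u})

/-- The composite `M_i → M_{i+1} → ⋯ → M_j` of structure maps, for `i ≤ j` (and `0` for `j < i`). -/
noncomputable def trans (i : ℕ) : ∀ j, M.space i →ₗ[ZMod 2] M.space j
  | 0 => if h : i = 0 then h ▸ LinearMap.id else 0
  | j + 1 => if h : i = j + 1 then h ▸ LinearMap.id else M.map j ∘ₗ trans i j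

theorem trans_self (i : ℕ) : M.trans i i = LinearMap.id := by
  cases i <;> simp [trans]

theorem trans_succ {i j : ℕ} (h : i ≤ j) : M.trans i (j + 1) = M.map j ∘ₗ M.trans i j := by
  rw [trans, dif_neg (by omega)]

theorem trans_trans {i j k : ℕ} (hij : i ≤ j) (hjk : j ≤ k) (x : M.space i) :
    M.trans j k (M.trans i j x) = M.trans i k x := by
  induction k, hjk using Nat.le_induction with
  | base => simp [trans_self]
  | succ k hk ih => rw [trans_succ _ hk, trans_succ _ (hij.trans hk)]; simp [ih]

/-- The rank of `M_i → M_j`. -/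
noncomputable def rank (i j : ℕ) : ℕ := Module.finrank (ZMod 2) (LinearMap.range (M.trans i j))

end PersistenceModule

namespace IntervalDecomposition

variable {M : PersistenceModule.{u}} {ι : Type} (I : IntervalDecomposition M ι)

theorem trans_gen_of_lt {s : ι} {i j : ℕ} (hi : I.birth s ≤ i) (hij : i ≤ j)
    (hj : (j : ℕ∞) < I.death s) : M.trans i j (I.gen s i) = I.gen s j := by
  induction j, hij using Nat.le_induction with
  | base => simp [PersistenceModule.trans_self]
  | succ j hj' ih =>
    rw [M.trans_succ hj', LinearMap.comp_apply, ih (lt_trans (by exact_mod_cast j.lt_succ_self) hj)]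
    exact I.map_gen s j (hi.trans hj') hj

theorem trans_gen_of_le {s : ι} {i j : ℕ} (hi : I.birth s ≤ i) (hid : (i : ℕ∞) < I.death s)
    (hj : I.death s ≤ j) : M.trans i j (I.gen s i) = 0 := by
  have hd : I.death s ≠ ⊤ := ne_top_of_le_ne_top (ENat.natCast_ne_top j) hj
  obtain ⟨d, hd⟩ := ENat.ne_top_iff_exists.1 hd
  rw [← hd] at hid hj
  have hid' : i < d := by exact_mod_cast hid
  have hj' : d ≤ j := by exact_mod_cast hj
  obtain ⟨e, rfl⟩ : ∃ e, d = e + 1 := ⟨d - 1, by omega⟩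
  have hie : i ≤ e := by omega
  rw [← M.trans_trans (hie.trans e.le_succ) hj', M.trans_succ hie, LinearMap.comp_apply,
    I.trans_gen_of_lt hi hie (by rw [← hd]; exact_mod_cast e.lt_succ_self),
    I.map_gen_last s e (hi.trans hie) hd.symm, map_zero]

/-- A generator alive at time `i` is carried to the generator at time `j` if its bar reaches that
far, and to `0` otherwise. -/
theorem range_trans {i j : ℕ} (hij : i ≤ j) : LinearMap.range (M.trans i j) =
    Submodule.span (ZMod 2) (Set.range
      (fun s : {s : ι // I.birth s ≤ i ∧ (j : ℕ∞) < I.death s} => I.gen s.1 j)) := by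
  have hij' : (i : ℕ∞) ≤ j := by exact_mod_cast hij
  rw [LinearMap.range_eq_map, ← I.span_eq_top i, Submodule.map_span]
  apply le_antisymm
  · rw [Submodule.span_le]
    rintro _ ⟨_, ⟨s, rfl⟩, rfl⟩
    by_cases hj : (j : ℕ∞) < I.death s.1
    · exact Submodule.subset_span ⟨⟨s.1, s.2.1, hj⟩, (I.trans_gen_of_lt s.2.1 hij hj).symm⟩
    · simp [I.trans_gen_of_le s.2.1 s.2.2 (not_lt.1 hj)]
  · rw [Submodule.span_le]
    rintro _ ⟨s, rfl⟩
    exact Submodule.subset_span ⟨_, ⟨⟨s.1, s.2.1, hij'.trans_lt s.2.2⟩, rfl⟩,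
      I.trans_gen_of_lt s.2.1 hij s.2.2⟩

/-- The generators spanning the image are part of the basis at time `j`, hence independent. The
right-hand side does not mention the decomposition; this is the source of uniqueness. -/
theorem countP_diagram [Fintype ι] {i j : ℕ} (hij : i ≤ j) :
    I.diagram.countP (fun p => p.1 ≤ i ∧ (j : ℕ∞) < p.2) = M.rank i j := by
  classical
  have hli : LinearIndependent (ZMod 2)
      (fun s : {s : ι // I.birth s ≤ i ∧ (j : ℕ∞) < I.death s} => I.gen s.1 j) :=
    (I.linearIndependent j).comp
      (fun s : {s : ι // I.birth s ≤ i ∧ (j : ℕ∞) < I.death s} => ⟨s.1, s.2.1.trans hij, s.2.2⟩)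
      (fun s t h => Subtype.ext (congrArg (fun x => x.1) h))
  rw [PersistenceModule.rank, I.range_trans hij, finrank_span_eq_card hli, Fintype.card_subtype,
    diagram, Multiset.countP_map]
  rfl

theorem lt_of_mem_diagram [Fintype ι] {p : ℕ × ℕ∞} (hp : p ∈ I.diagram) : (p.1 : ℕ∞) < p.2 := by
  obtain ⟨s, -, rfl⟩ := Multiset.mem_map.1 hp
  exact I.birth_lt_death s

end IntervalDecomposition

/-! ### A diagram is determined by its ranks -/

namespace Diagram

/-- Difference in the birth coordinate: born by `b + 1` minus born by `b`. For `b = 0` there is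
nothing to subtract. -/
theorem countP_birth_eq {D D' : Diagram}
    (h : ∀ i j : ℕ, i ≤ j → D.countP (fun p => p.1 ≤ i ∧ (j : ℕ∞) < p.2) =
      D'.countP (fun p => p.1 ≤ i ∧ (j : ℕ∞) < p.2)) {b j : ℕ} (hbj : b ≤ j) :
    D.countP (fun p => p.1 = b ∧ (j : ℕ∞) < p.2) =
      D'.countP (fun p => p.1 = b ∧ (j : ℕ∞) < p.2) := by
  obtain _ | b := b
  · simpa using h 0 j hbj
  · have key : ∀ E : Diagram, E.countP (fun p => p.1 ≤ b + 1 ∧ (j : ℕ∞) < p.2) =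
        E.countP (fun p => p.1 ≤ b ∧ (j : ℕ∞) < p.2) +
          E.countP (fun p => p.1 = b + 1 ∧ (j : ℕ∞) < p.2) := by
      intro E
      induction E using Multiset.induction_on with
      | empty => simp
      | cons p E ih =>
        simp only [Multiset.countP_cons, ih]
        split_ifs <;> first | omega | (exfalso; grind)
    have h1 := h (b + 1) j hbj
    have h2 := h b j (by omega)
    rw [key, key] at h1
    omega

theorem exists_forall_death_le (D : Diagram) : ∃ T : ℕ, ∀ p ∈ D, p.2 ≠ ⊤ → p.2 ≤ T := by
  induction D using Multiset.induction_on with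
  | empty => exact ⟨0, by simp⟩
  | cons p D ih =>
    obtain ⟨T, hT⟩ := ih
    refine ⟨max T p.2.toNat, fun q hq hq' => ?_⟩
    rcases Multiset.mem_cons.1 hq with rfl | hq
    · conv_lhs => rw [← ENat.natCast_toNat hq']
      exact_mod_cast le_max_right _ _
    · exact (hT q hq hq').trans (by exact_mod_cast le_max_left _ _)

/-- A finite death time `e + 1` is isolated by the difference between being alive at `e` and at `e +
1`; an infinite one by being alive after all finite deaths. Pairs with death not after birth are
invisible to the counts, so they are excluded by hypothesis. -/
theorem eq_of_countP_eq {D D' : Diagram} (hD : ∀ p ∈ D, (p.1 : ℕ∞) < p.2)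
    (hD' : ∀ p ∈ D', (p.1 : ℕ∞) < p.2)
    (h : ∀ i j : ℕ, i ≤ j → D.countP (fun p => p.1 ≤ i ∧ (j : ℕ∞) < p.2) =
      D'.countP (fun p => p.1 ≤ i ∧ (j : ℕ∞) < p.2)) : D = D' := by
  refine Multiset.ext.2 fun ⟨b, d⟩ => ?_
  induction d using ENat.recTopCoe with
  | top =>
    obtain ⟨T, hT⟩ := D.exists_forall_death_le
    obtain ⟨T', hT'⟩ := D'.exists_forall_death_le
    -- The test time bounds the finite deaths of both diagrams, and is at least `b` because the
    -- counts are only known to agree when `i ≤ j`.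
    have key : ∀ E : Diagram, (∀ p ∈ E, p.2 ≠ ⊤ → p.2 ≤ (max b (max T T') : ℕ)) →
        E.count (b, ⊤) = E.countP (fun p => p.1 = b ∧ ((max b (max T T') : ℕ) : ℕ∞) < p.2) := by
      intro E hE
      refine Multiset.countP_congr rfl fun p hp => ?_
      obtain ⟨c, d⟩ := p
      simp only [eq_iff_iff, Prod.mk.injEq]
      constructor
      · rintro ⟨rfl, rfl⟩
        exact ⟨rfl, ENat.natCast_lt_top _⟩
      · rintro ⟨rfl, hd⟩
        exact ⟨rfl, by by_contra hne; exact absurd (hE _ hp (Ne.symm hne)) (not_le.2 hd)⟩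
    rw [key D fun p hp hp' => (hT p hp hp').trans (by exact_mod_cast by omega),
      key D' fun p hp hp' => (hT' p hp hp').trans (by exact_mod_cast by omega)]
    exact countP_birth_eq h (le_max_left _ _)
  | coe d =>
    by_cases hbd : b < d
    · obtain ⟨e, rfl⟩ : ∃ e, d = e + 1 := ⟨d - 1, by omega⟩
      have key : ∀ E : Diagram, E.countP (fun p => p.1 = b ∧ (e : ℕ∞) < p.2) =
          E.countP (fun p => p.1 = b ∧ ((e + 1 : ℕ) : ℕ∞) < p.2) +
            E.count (b, ((e + 1 : ℕ) : ℕ∞)) := by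
        intro E
        induction E using Multiset.induction_on with
        | empty => simp
        | cons p E ih =>
          obtain ⟨c, d⟩ := p
          simp only [Multiset.countP_cons, Multiset.count_cons, ih, Prod.mk.injEq]
          have h1 : (e : ℕ∞) < d ↔ ((e + 1 : ℕ) : ℕ∞) < d ∨ ((e + 1 : ℕ) : ℕ∞) = d := by
            rw [← le_iff_lt_or_eq, Nat.cast_add, Nat.cast_one, ENat.add_one_le_iff (by simp)]
          have h2 : ((e + 1 : ℕ) : ℕ∞) = d → ¬ ((e + 1 : ℕ) : ℕ∞) < d := fun h => by simp [h]
          split_ifs <;> first | omega | (exfalso; grind)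
      have h1 := countP_birth_eq h (b := b) (j := e) (by omega)
      have h2 := countP_birth_eq h (b := b) (j := e + 1) (by omega)
      rw [key, key] at h1
      omega
    · have key : ∀ E : Diagram, (∀ p ∈ E, (p.1 : ℕ∞) < p.2) → E.count (b, (d : ℕ∞)) = 0 :=
        fun E hE => Multiset.count_eq_zero.2 fun hm => hbd (Nat.cast_lt.1 (hE _ hm))
      rw [key D hD, key D' hD']

end Diagram

/-! ### Existence of interval decompositions -/

/-- In a vanishing combination, the term of largest index with nonzero coefficient could be solved
for in terms of the smaller ones. -/
theorem linearIndependent_of_notMem_span_lt {K V ι : Type*} [Field K] [AddCommGroup V] [Module K V]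
    [LinearOrder ι] {g : ι → V} (h : ∀ s, g s ∉ Submodule.span K (g '' {t | t < s})) :
    LinearIndependent K g := by
  classical
  rw [linearIndependent_iff']
  intro A c hc
  by_contra! hne
  have hB : (A.filter fun i => c i ≠ 0).Nonempty := by
    obtain ⟨i, hi, hci⟩ := hne
    exact ⟨i, Finset.mem_filter.2 ⟨hi, hci⟩⟩
  set B := A.filter fun i => c i ≠ 0 with hBdef
  have hsum : ∑ i ∈ B, c i • g i = 0 := by
    rw [← hc, hBdef, Finset.sum_filter_of_ne]
    intro i _ hi h0
    exact hi (by rw [h0, zero_smul])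
  set s := B.max' hB
  have hs : s ∈ B := B.max'_mem hB
  have hcs : c s ≠ 0 := (Finset.mem_filter.1 hs).2
  rw [← Finset.add_sum_erase _ _ hs] at hsum
  refine h s ((Submodule.smul_mem_iff _ hcs).1 ?_)
  rw [eq_neg_of_add_eq_zero_left hsum]
  refine Submodule.neg_mem _ (Submodule.sum_mem _ fun t ht => Submodule.smul_mem _ _ ?_)
  exact Submodule.subset_span ⟨t, B.lt_max'_of_mem_erase_max' hB ht, rfl⟩

namespace PersistenceModule

variable (M : PersistenceModule.{u})

/-- The first time at which a class born at time `b` vanishes. -/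
noncomputable def deathTime {b : ℕ} (v : M.space b) : ℕ∞ :=
  sInf ((fun j : ℕ => (j : ℕ∞)) '' {j | b ≤ j ∧ M.trans b j v = 0})

/-- A class that has vanished stays zero. If it never vanishes, the infimum is over the empty set
and equals `⊤`. -/
theorem lt_deathTime_iff {b i : ℕ} (hb : b ≤ i) (v : M.space b) :
    (i : ℕ∞) < M.deathTime v ↔ M.trans b i v ≠ 0 := by
  constructor
  · intro h h0
    exact absurd h (not_lt.2 (sInf_le ⟨i, ⟨hb, h0⟩, rfl⟩))
  · intro h
    by_contra hle
    have hlt : M.deathTime v < ((i + 1 : ℕ) : ℕ∞) :=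
      lt_of_le_of_lt (not_lt.1 hle) (by exact_mod_cast i.lt_succ_self)
    obtain ⟨_, ⟨j, ⟨hbj, hj⟩, rfl⟩, hji⟩ := sInf_lt_iff.1 hlt
    have hji' : j ≤ i := Nat.lt_succ_iff.1 (Nat.cast_lt.1 hji)
    exact h (by rw [← M.trans_trans hbj hji', hj, map_zero])

/-- The image of the previous space in `M_b`. -/
noncomputable def prevRange : ∀ b, Submodule (ZMod 2) (M.space b)
  | 0 => ⊥
  | b + 1 => LinearMap.range (M.map b)

theorem trans_mem_prevRange {a b : ℕ} (h : a < b) (v : M.space a) :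
    M.trans a b v ∈ M.prevRange b := by
  obtain ⟨b, rfl⟩ : ∃ c, b = c + 1 := ⟨b - 1, by omega⟩
  rw [M.trans_succ (by omega)]
  exact ⟨_, rfl⟩

variable [∀ i, Finite (M.space i)]

/-- An injective key that orders each space by death time first. -/
noncomputable def key {b : ℕ} (v : M.space b) : ℕ∞ ×ₗ ℕ :=
  toLex (M.deathTime v, (Finite.equivFin (M.space b) v : ℕ))

theorem key_injective {b : ℕ} : Function.Injective (M.key (b := b)) := by
  intro v w h
  have h2 := congrArg (fun x => (ofLex x).2) h
  exact (Finite.equivFin (M.space b)).injective (Fin.ext h2)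

theorem key_lt_of_deathTime_lt {b : ℕ} {v w : M.space b} (h : M.deathTime v < M.deathTime w) :
    M.key v < M.key w :=
  Prod.Lex.toLex_lt_toLex.2 (Or.inl h)

/-- The span of the classes in `M_b` that are older than `v` or come before `v`. -/
noncomputable def prior {b : ℕ} (v : M.space b) : Submodule (ZMod 2) (M.space b) :=
  M.prevRange b ⊔ Submodule.span (ZMod 2) {w | M.key w < M.key v}

/-- The generators chosen by the greedy algorithm: the classes that are not combinations of
older and prior ones. -/
def Generator : Type u := Σ b, {v : M.space b // v ∉ M.prior v}

variable {M}

/-- The exchange argument behind the greedy choice. If `v` and a prior `y` had the same image at a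
time when `v` is alive, then `v - y` would die before `v`, so it would be prior to `v`; then `v = (v
- y) + y` would be prior to itself. -/
theorem Generator.trans_notMem {i : ℕ} (s : M.Generator) (hb : s.1 ≤ i)
    (hd : M.trans s.1 i s.2.1 ≠ 0) {y : M.space s.1} (hy : y ∈ M.prior s.2.1) :
    M.trans s.1 i s.2.1 ≠ M.trans s.1 i y := by
  intro h
  refine s.2.2 ?_
  have h0 : M.trans s.1 i (s.2.1 - y) = 0 := by rw [map_sub, h, sub_self]
  have hlt : M.key (s.2.1 - y) < M.key s.2.1 := by
    refine M.key_lt_of_deathTime_lt (lt_of_le_of_lt (not_lt.1 fun h1 => ?_)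
      ((M.lt_deathTime_iff hb _).2 hd))
    exact (M.lt_deathTime_iff hb _).1 h1 h0
  have hmem : s.2.1 - y ∈ M.prior s.2.1 := Submodule.mem_sup_right (Submodule.subset_span hlt)
  simpa using Submodule.add_mem _ hmem hy

theorem Generator.linearIndependent (i : ℕ) : LinearIndependent (ZMod 2)
    (fun s : {s : M.Generator // s.1 ≤ i ∧ M.trans s.1 i s.2.1 ≠ 0} =>
      M.trans s.1.1 i s.1.2.1) := by
  -- Ordered by birth and then key, the generators before `s` have images at time `i` that come from
  -- the prior classes of `s`, so the exchange argument applies.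
  let o : {s : M.Generator // s.1 ≤ i ∧ M.trans s.1 i s.2.1 ≠ 0} → ℕ ×ₗ (ℕ∞ ×ₗ ℕ) :=
    fun s => toLex (s.1.1, M.key s.1.2.1)
  have ho : Function.Injective o := by
    rintro ⟨⟨b, v, hv⟩, h⟩ ⟨⟨c, w, hw⟩, h'⟩ hst
    have hst' := toLex_inj.1 hst
    simp only [Prod.mk.injEq] at hst'
    obtain ⟨rfl, hk⟩ := hst'
    obtain rfl := M.key_injective hk
    rfl
  let _ : LinearOrder {s : M.Generator // s.1 ≤ i ∧ M.trans s.1 i s.2.1 ≠ 0} :=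
    LinearOrder.lift' o ho
  refine linearIndependent_of_notMem_span_lt fun s hs => ?_
  have hle : Submodule.span (ZMod 2) ((fun s : {s : M.Generator // s.1 ≤ i ∧
      M.trans s.1 i s.2.1 ≠ 0} => M.trans s.1.1 i s.1.2.1) '' {t | t < s}) ≤
      (M.prior s.1.2.1).map (M.trans s.1.1 i) := by
    rw [Submodule.span_le]
    rintro _ ⟨t, ht, rfl⟩
    obtain ⟨⟨b, v, hv⟩, hb, hvi⟩ := s
    obtain ⟨⟨c, w, hw⟩, hc, hwi⟩ := t
    have ht' : o ⟨⟨c, w, hw⟩, hc, hwi⟩ < o ⟨⟨b, v, hv⟩, hb, hvi⟩ := ht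
    rcases Prod.Lex.toLex_lt_toLex.1 ht' with h | ⟨h, h'⟩
    · exact ⟨M.trans c b w, Submodule.mem_sup_left (M.trans_mem_prevRange h w),
        M.trans_trans h.le hb w⟩
    · obtain rfl : c = b := h
      exact ⟨w, Submodule.mem_sup_right (Submodule.subset_span h'), rfl⟩
  obtain ⟨y, hy, hyi⟩ := hle hs
  exact s.1.trans_notMem s.2.1 s.2.2 hy hyi.symm

theorem Generator.span_eq_top (i : ℕ) : Submodule.span (ZMod 2) (Set.range
    (fun s : {s : M.Generator // s.1 ≤ i ∧ M.trans s.1 i s.2.1 ≠ 0} =>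
      M.trans s.1.1 i s.1.2.1)) = ⊤ := by
  have main : ∀ i, M.prevRange i ≤ Submodule.span (ZMod 2) (Set.range
      (fun s : {s : M.Generator // s.1 ≤ i ∧ M.trans s.1 i s.2.1 ≠ 0} =>
        M.trans s.1.1 i s.1.2.1)) → Submodule.span (ZMod 2) (Set.range
      (fun s : {s : M.Generator // s.1 ≤ i ∧ M.trans s.1 i s.2.1 ≠ 0} =>
        M.trans s.1.1 i s.1.2.1)) = ⊤ := by
    intro i hi
    rw [eq_top_iff]
    rintro v -
    -- Induction on the key: `v` is either a generator itself or a combination of older classes and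
    -- classes of smaller key.
    have hwf : WellFounded (fun v w : M.space i => M.key v < M.key w) :=
      InvImage.wf _ wellFounded_lt
    induction v using hwf.induction with
    | _ v ih =>
      by_cases hv : v ∈ M.prior v
      · exact (sup_le hi (Submodule.span_le.2 fun w hw => ih w hw)) hv
      · have hv0 : v ≠ 0 := fun h0 => hv (h0 ▸ Submodule.zero_mem _)
        exact Submodule.subset_span
          ⟨⟨⟨i, v, hv⟩, le_rfl, by simpa [trans_self] using hv0⟩, by simp [trans_self]⟩
  induction i with
  | zero => exact main 0 bot_le
  | succ i ih =>
    refine main (i + 1) ?_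
    rw [prevRange, LinearMap.range_eq_map, ← ih, Submodule.map_span, Submodule.span_le]
    rintro _ ⟨_, ⟨s, rfl⟩, rfl⟩
    have hs : M.map i (M.trans s.1.1 i s.1.2.1) = M.trans s.1.1 (i + 1) s.1.2.1 := by
      rw [M.trans_succ s.2.1, LinearMap.comp_apply]
    change M.map i (M.trans s.1.1 i s.1.2.1) ∈ _
    rw [hs]
    by_cases h0 : M.trans s.1.1 (i + 1) s.1.2.1 = 0
    · rw [h0]
      exact Submodule.zero_mem _
    · exact Submodule.subset_span ⟨⟨s.1, s.2.1.trans i.le_succ, h0⟩, rfl⟩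

/-- After time `T` every class is the image of an older one, so no generator is born; up to `T`
there are finitely many finite spaces. -/
theorem Generator.finite {T : ℕ} (hT : ∀ i, T ≤ i → Function.Surjective (M.map i)) :
    Finite M.Generator := by
  have hlt : ∀ s : M.Generator, s.1 < T + 1 := by
    rintro ⟨b, v, hv⟩
    by_contra hb
    change ¬ b < T + 1 at hb
    obtain ⟨b, rfl⟩ : ∃ c, b = c + 1 := ⟨b - 1, by omega⟩
    exact hv (Submodule.mem_sup_left (hT b (by omega) v))
  refine Finite.of_injective
    (fun s : M.Generator => (⟨⟨s.1, hlt s⟩, s.2.1⟩ : Σ b : Fin (T + 1), M.space b)) ?_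
  rintro ⟨b, v, hv⟩ ⟨c, w, hw⟩ h
  simp only [Sigma.mk.injEq, Fin.mk.injEq] at h
  obtain ⟨rfl, h⟩ := h
  obtain rfl := eq_of_heq h
  rfl

/-- The interval decomposition given by the greedy generators, indexed by any type `ι` in
bijection with them. -/
noncomputable def Generator.decomposition {ι : Type} (e : ι ≃ M.Generator) :
    IntervalDecomposition M ι where
  birth s := (e s).1
  death s := M.deathTime (e s).2.1
  birth_lt_death s := by
    rw [M.lt_deathTime_iff le_rfl, trans_self]
    intro h0
    change (e s).2.1 = 0 at h0
    exact (e s).2.2 (by simp [h0])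
  gen s i := M.trans (e s).1 i (e s).2.1
  linearIndependent i :=
    (Generator.linearIndependent i).comp
      (fun s : {s : ι // (e s).1 ≤ i ∧ (i : ℕ∞) < M.deathTime (e s).2.1} =>
        ⟨e s.1, s.2.1, (M.lt_deathTime_iff s.2.1 _).1 s.2.2⟩)
      (fun s t h => Subtype.ext (e.injective (congrArg (fun x => x.1) h)))
  span_eq_top i := by
    rw [← Generator.span_eq_top i]
    congr 1
    ext x
    constructor
    · rintro ⟨s, rfl⟩
      exact ⟨⟨e s.1, s.2.1, (M.lt_deathTime_iff s.2.1 _).1 s.2.2⟩, rfl⟩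
    · rintro ⟨⟨s, h1, h2⟩, rfl⟩
      obtain ⟨s, rfl⟩ := e.surjective s
      exact ⟨⟨s, h1, (M.lt_deathTime_iff h1 _).2 h2⟩, rfl⟩
  map_gen s i hi _ := by rw [M.trans_succ hi, LinearMap.comp_apply]
  map_gen_last s i hi hd := by
    by_contra h0
    rw [← LinearMap.comp_apply, ← M.trans_succ hi] at h0
    have := (M.lt_deathTime_iff (hi.trans i.le_succ) (e s).2.1).2 h0
    rw [hd] at this
    exact lt_irrefl _ this

theorem exists_intervalDecomposition {T : ℕ}
    (hT : ∀ i, T ≤ i → Function.Surjective (M.map i)) :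
    ∃ m, Nonempty (IntervalDecomposition M (Fin m)) := by
  have := Generator.finite hT
  -- Reindexing by `Fin` brings the index type from `Type u` down to `Type`.
  exact ⟨_, ⟨Generator.decomposition (Finite.equivFin M.Generator).symm⟩⟩

theorem exists_isPersistenceDiagram {T : ℕ}
    (hT : ∀ i, T ≤ i → Function.Surjective (M.map i)) : ∃ D, IsPersistenceDiagram M D := by
  obtain ⟨m, ⟨I⟩⟩ := exists_intervalDecomposition hT
  refine ⟨I.diagram, ⟨Fin m, inferInstance, I, rfl⟩, fun ι _ J => ?_⟩
  refine Diagram.eq_of_countP_eq (fun _ => J.lt_of_mem_diagram) (fun _ => I.lt_of_mem_diagram) ?_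
  intro i j hij
  rw [J.countP_diagram hij, I.countP_diagram hij]

end PersistenceModule

namespace IsPersistenceDiagram

variable {M : PersistenceModule.{u}} {D : Diagram}

theorem lt_of_mem (h : IsPersistenceDiagram M D) {p : ℕ × ℕ∞} (hp : p ∈ D) :
    (p.1 : ℕ∞) < p.2 := by
  obtain ⟨ι, _, I, rfl⟩ := h.1
  exact I.lt_of_mem_diagram hp

theorem countP_eq_rank (h : IsPersistenceDiagram M D) {i j : ℕ} (hij : i ≤ j) :
    D.countP (fun p => p.1 ≤ i ∧ (j : ℕ∞) < p.2) = M.rank i j := by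
  obtain ⟨ι, _, I, rfl⟩ := h.1
  exact I.countP_diagram hij

end IsPersistenceDiagram

/-- Identifies a diagram by counting alone, with no decomposition to exhibit: one exists, and its
diagram has the same counts. -/
theorem isPersistenceDiagram_of_rank {M : PersistenceModule.{u}} [∀ i, Finite (M.space i)] {T : ℕ}
    (hT : ∀ i, T ≤ i → Function.Surjective (M.map i)) {D : Diagram}
    (hD : ∀ p ∈ D, (p.1 : ℕ∞) < p.2)
    (hr : ∀ i j : ℕ, i ≤ j → D.countP (fun p => p.1 ≤ i ∧ (j : ℕ∞) < p.2) = M.rank i j) :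
    IsPersistenceDiagram M D := by
  obtain ⟨D', h⟩ := PersistenceModule.exists_isPersistenceDiagram hT
  obtain rfl : D = D' := Diagram.eq_of_countP_eq hD (fun _ => h.lt_of_mem) fun i j hij => by
    rw [hr i j hij, h.countP_eq_rank hij]
  exact h

section Homology

variable {α β : Type u} {X Y Z : Graph α β}

/-! ### Functoriality of graph homology -/

namespace CellMap

theorem map₁_apply (φ : CellMap X Y) (c : β →₀ ZMod 2) (e : β) [Decidable (e ∈ E(Y))] :
    φ.map₁ c e = if e ∈ E(Y) then c e else 0 := by
  classical
  induction c using Finsupp.induction_linear with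
  | zero => simp
  | add c d hc hd => rw [map_add, Finsupp.add_apply, hc, hd]; split_ifs <;> simp
  | single e' x =>
    rw [map₁, Finsupp.linearCombination_single]
    by_cases h : e' = e
    · subst h
      split_ifs <;> simp
    · split_ifs <;> simp [h]

theorem onH₁_apply (φ : CellMap X Y) (c : H₁ X) (e : β) [Decidable (e ∈ E(Y))] :
    (φ.onH₁ c).1 e = if e ∈ E(Y) then c.1 e else 0 :=
  φ.map₁_apply c.1 e

theorem map₀_congr {Y' : Graph α β} {φ : CellMap X Y} {ψ : CellMap X Y'}
    (h : ∀ x ∈ V(X), φ.onVert x = ψ.onVert x) {c : α →₀ ZMod 2} (hc : c ∈ chains₀ X) :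
    φ.map₀ c = ψ.map₀ c :=
  Finsupp.mapDomain_congr fun x hx => h x ((Finsupp.mem_supported _ _).1 hc hx)

theorem onH₀_congr {φ ψ : CellMap X Y} (h : ∀ x ∈ V(X), φ.onVert x = ψ.onVert x) :
    φ.onH₀ = ψ.onH₀ := by
  refine Submodule.linearMap_qext _ (LinearMap.ext fun c => ?_)
  exact congrArg (Submodule.Quotient.mk (p := boundaries₀ Y)) (Subtype.ext (map₀_congr h c.2))

/-- On 1-chains a cellular map only erases the edges missing from the target, so the vertex map
plays no role. -/
theorem onH₁_congr (φ ψ : CellMap X Y) : φ.onH₁ = ψ.onH₁ := by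
  classical
  refine LinearMap.ext fun c => Subtype.ext (Finsupp.ext fun e => ?_)
  rw [onH₁_apply, onH₁_apply]

theorem onH₀_eq_id {φ : CellMap X X} (h : ∀ x ∈ V(X), φ.onVert x = x) :
    φ.onH₀ = LinearMap.id := by
  refine Submodule.linearMap_qext _ (LinearMap.ext fun c => ?_)
  refine congrArg (Submodule.Quotient.mk (p := boundaries₀ X)) (Subtype.ext ?_)
  change Finsupp.mapDomain φ.onVert c.1 = c.1
  conv_rhs => rw [← Finsupp.mapDomain_id (v := c.1)]
  exact Finsupp.mapDomain_congr fun x hx => h x ((Finsupp.mem_supported _ _).1 c.2 hx)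

theorem onH₁_eq_id (φ : CellMap X X) : φ.onH₁ = LinearMap.id := by
  classical
  refine LinearMap.ext fun c => Subtype.ext (Finsupp.ext fun e => ?_)
  rw [onH₁_apply, LinearMap.id_apply]
  split_ifs with he
  · rfl
  · by_contra h
    exact he ((Finsupp.mem_supported _ _).1 c.2.1 (Finsupp.mem_support_iff.2 (Ne.symm h)))

theorem onH₀_comp {φ : CellMap X Y} {ψ : CellMap Y Z} {χ : CellMap X Z}
    (h : ∀ x ∈ V(X), ψ.onVert (φ.onVert x) = χ.onVert x) : ψ.onH₀ ∘ₗ φ.onH₀ = χ.onH₀ := by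
  refine Submodule.linearMap_qext _ (LinearMap.ext fun c => ?_)
  refine congrArg (Submodule.Quotient.mk (p := boundaries₀ Z)) (Subtype.ext ?_)
  change Finsupp.mapDomain ψ.onVert (Finsupp.mapDomain φ.onVert c.1) =
    Finsupp.mapDomain χ.onVert c.1
  rw [← Finsupp.mapDomain_comp]
  exact Finsupp.mapDomain_congr fun x hx => h x ((Finsupp.mem_supported _ _).1 c.2 hx)

/-- The hypothesis rules out an edge that is absent from `Y` but present again in `Z`: the composite
would erase it, the direct map would not. -/
theorem onH₁_comp {φ : CellMap X Y} {ψ : CellMap Y Z} {χ : CellMap X Z}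
    (h : ∀ e ∈ E(X), e ∈ E(Z) → e ∈ E(Y)) : ψ.onH₁ ∘ₗ φ.onH₁ = χ.onH₁ := by
  classical
  refine LinearMap.ext fun c => Subtype.ext (Finsupp.ext fun e => ?_)
  rw [LinearMap.comp_apply, onH₁_apply, onH₁_apply, onH₁_apply]
  by_cases he : c.1 e = 0
  · simp [he]
  · have := h e ((Finsupp.mem_supported _ _).1 c.2.1 (Finsupp.mem_support_iff.2 he))
    split_ifs <;> simp_all

/-- The rank of the map induced on `H_k`. -/
noncomputable def homologyRank : ℕ → CellMap X Y → ℕ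
  | 0, φ => Module.finrank (ZMod 2) (LinearMap.range φ.onH₀)
  | 1, φ => Module.finrank (ZMod 2) (LinearMap.range φ.onH₁)
  | _ + 2, _ => 0

theorem homologyRank_congr {X' Y' : Graph α β} {φ : CellMap X Y} {ψ : CellMap X' Y'}
    (hX : X = X') (hY : Y = Y') (h : ∀ x ∈ V(X), φ.onVert x = ψ.onVert x) (k : ℕ) :
    φ.homologyRank k = ψ.homologyRank k := by
  subst hX hY
  match k with
  | 0 => rw [homologyRank, homologyRank, onH₀_congr h]
  | 1 => rw [homologyRank, homologyRank, onH₁_congr φ ψ]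
  | _ + 2 => rfl

end CellMap

/-- Over `ℤ/2`, finitely many cells span a finite set of chains, which the enumeration in the greedy
construction needs. -/
theorem finite_supported {γ : Type*} {s : Set γ} (hs : s.Finite) :
    Finite (Finsupp.supported (ZMod 2) (ZMod 2) s) := by
  have := hs.to_subtype
  have : Finite (s →₀ ZMod 2) := Finite.of_injective _ DFunLike.coe_injective
  exact Finite.of_equiv _ (Finsupp.supportedEquivFinsupp (R := ZMod 2) (M := ZMod 2) s).toEquiv.symm

theorem finite_H₀ (h : V(X).Finite) : Finite (H₀ X) := by
  have : Finite (chains₀ X) := finite_supported h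
  exact Finite.of_surjective _ (Submodule.mkQ_surjective (boundaries₀ X))

theorem finite_H₁ (h : E(X).Finite) : Finite (H₁ X) := by
  have : Finite (chains₁ X) := finite_supported h
  exact Finite.of_injective (Submodule.inclusion (inf_le_left : cycles₁ X ≤ chains₁ X))
    (Submodule.inclusion_injective _)

theorem GraphSequence.finite_persistentHomology {S : GraphSequence α β}
    (hV : ∀ i, V(S.graph i).Finite) (hE : ∀ i, E(S.graph i).Finite) (k i : ℕ) :
    Finite ((S.persistentHomology k).space i) :=
  match k with
  | 0 => finite_H₀ (hV i)
  | 1 => finite_H₁ (hE i)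
  | _ + 2 => inferInstanceAs (Finite PUnit)

theorem GraphSequence.surjective_persistentHomology_map {S : GraphSequence α β} {i : ℕ}
    (h : S.graph i = S.graph (i + 1)) (h' : ∀ x ∈ V(S.graph i), (S.map i).onVert x = x) (k : ℕ) :
    Function.Surjective ((S.persistentHomology k).map i) := by
  have key : ∀ {X Y : Graph α β} (φ : CellMap X Y), X = Y → (∀ x ∈ V(X), φ.onVert x = x) →
      Function.Surjective φ.onH₀ ∧ Function.Surjective φ.onH₁ := by
    rintro X _ φ rfl hφ
    rw [CellMap.onH₀_eq_id hφ, CellMap.onH₁_eq_id]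
    exact ⟨Function.surjective_id, Function.surjective_id⟩
  match k with
  | 0 => exact (key (S.map i) h h').1
  | 1 => exact (key (S.map i) h h').2
  | _ + 2 => exact fun x => ⟨x, rfl⟩

end Homology

/-! ### Sequences of stages -/

namespace FiltrationFunction

variable {α β : Type u} {G : Graph α β} (f : FiltrationFunction G)

theorem mem_stage_vertexSet {i j : ℕ} {a : Option α} : a ∈ V(f.stage i j) ↔
    ∃ x ∈ V(G), f.step (f.onVert x) ≤ i ∧ collapse (f.contractedVerts j) x = a := by
  constructor
  · rintro ⟨x, hx, rfl⟩
    exact ⟨x, hx.1, hx.2, rfl⟩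
  · rintro ⟨x, hx, hi, rfl⟩
    exact ⟨x, ⟨hx, hi⟩, rfl⟩

theorem stage_vertexSet_finite (h : V(G).Finite) (i j : ℕ) : V(f.stage i j).Finite :=
  (h.image (collapse (f.contractedVerts j))).subset fun _ ha => by
    obtain ⟨x, hx, -, rfl⟩ := f.mem_stage_vertexSet.1 ha
    exact ⟨x, hx, rfl⟩

theorem stage_edgeSet_subset (i j : ℕ) : E(f.stage i j) ⊆ E(G) := by
  intro e he
  obtain ⟨a, b, hab⟩ := Graph.exists_isLink_of_mem_edgeSet he
  obtain ⟨x, y, h, -⟩ := f.stage_isLink.1 hab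
  exact h.edge_mem

theorem notMem_contractedEdges {i j : ℕ} {e : β} (he : e ∈ E(f.stage i j)) :
    e ∉ f.contractedEdges j := by
  obtain ⟨a, b, hab⟩ := Graph.exists_isLink_of_mem_edgeSet he
  obtain ⟨x, y, -, -, -, -, h, -⟩ := f.stage_isLink.1 hab
  exact h

theorem onH₀_stageMap_comp {i i' i'' j j' j'' : ℕ} (hi : i ≤ i') (hi' : i' ≤ i'') (hj : j ≤ j')
    (hj' : j' ≤ j'') : (f.stageMap hi' hj').onH₀ ∘ₗ (f.stageMap hi hj).onH₀ =
      (f.stageMap (hi.trans hi') (hj.trans hj')).onH₀ := by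
  refine CellMap.onH₀_comp fun a _ => ?_
  cases a with
  | none => rfl
  | some x => exact f.bind_collapse hj' x

theorem onH₁_stageMap_comp {i i' i'' j j' j'' : ℕ} (hi : i ≤ i') (hi' : i' ≤ i'') (hj : j ≤ j')
    (hj' : j' ≤ j'') : (f.stageMap hi' hj').onH₁ ∘ₗ (f.stageMap hi hj).onH₁ =
      (f.stageMap (hi.trans hi') (hj.trans hj')).onH₁ :=
  CellMap.onH₁_comp fun e he he' => by
    obtain ⟨a, b, hab⟩ := Graph.exists_isLink_of_mem_edgeSet he
    obtain ⟨x, y, h, h1, h2, h3, -⟩ := f.stage_isLink.1 hab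
    exact Graph.IsLink.edge_mem (f.stage_isLink.2 ⟨x, y, h, h1.trans hi, h2.trans hi,
      h3.trans hi, fun hc => f.notMem_contractedEdges he' (f.contractedEdges_mono hj' hc),
      rfl, rfl⟩)

/-- The sequence of stages along a monotone path of indices. -/
noncomputable def pathSequence {a b : ℕ → ℕ} (ha : Monotone a) (hb : Monotone b) :
    GraphSequence (Option α) β where
  graph t := f.stage (a t) (b t)
  map t := f.stageMap (ha t.le_succ) (hb t.le_succ)

theorem stageMap_onVert_self {i j : ℕ} {a : Option α} (ha : a ∈ V(f.stage i j)) :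
    a.bind (collapse (f.contractedVerts j)) = a := by
  obtain ⟨x, -, -, rfl⟩ := f.mem_stage_vertexSet.1 ha
  exact f.bind_collapse le_rfl x

section PathSequence

variable {a b : ℕ → ℕ} (ha : Monotone a) (hb : Monotone b)

theorem trans_pathSequence_zero {s t : ℕ} (h : s ≤ t) :
    ((f.pathSequence ha hb).persistentHomology 0).trans s t =
      (f.stageMap (ha h) (hb h)).onH₀ := by
  induction t, h using Nat.le_induction with
  | base =>
    rw [PersistenceModule.trans_self]
    exact (CellMap.onH₀_eq_id fun x hx => f.stageMap_onVert_self hx).symm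
  | succ t h ih =>
    rw [PersistenceModule.trans_succ _ h, ih]
    exact f.onH₀_stageMap_comp (ha h) (ha t.le_succ) (hb h) (hb t.le_succ)

theorem trans_pathSequence_one {s t : ℕ} (h : s ≤ t) :
    ((f.pathSequence ha hb).persistentHomology 1).trans s t =
      (f.stageMap (ha h) (hb h)).onH₁ := by
  induction t, h using Nat.le_induction with
  | base =>
    rw [PersistenceModule.trans_self]
    exact (CellMap.onH₁_eq_id _).symm
  | succ t h ih =>
    rw [PersistenceModule.trans_succ _ h, ih]
    exact f.onH₁_stageMap_comp (ha h) (ha t.le_succ) (hb h) (hb t.le_succ)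

/-- Composites of stage maps are stage maps, so the route between the two end stages does not
matter. This is what makes ranks of different sequences comparable. -/
theorem rank_pathSequence {s t : ℕ} (h : s ≤ t) (k : ℕ) :
    ((f.pathSequence ha hb).persistentHomology k).rank s t =
      (f.stageMap (ha h) (hb h)).homologyRank k := by
  match k with
  | 0 => rw [PersistenceModule.rank, trans_pathSequence_zero f ha hb h]; rfl
  | 1 => rw [PersistenceModule.rank, trans_pathSequence_one f ha hb h]; rfl
  | k + 2 =>
    have : Subsingleton (LinearMap.range
        (((f.pathSequence ha hb).persistentHomology (k + 2)).trans s t)) :=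
      ⟨fun x y => Subtype.ext (Subsingleton.elim (α := PUnit) _ _)⟩
    exact Module.finrank_zero_of_subsingleton

end PathSequence

/-! ### Stationarity of the grid of stages -/

theorem step_le_lastStep (hf : f.values.Finite) {t : ℝ} (ht : t ∈ f.values) :
    f.step t ≤ f.lastStep := by
  refine Nat.le_sub_one_of_lt (Set.ncard_lt_ncard ?_ hf)
  exact ⟨fun s hs => hs.1, fun h => lt_irrefl t (h ht).2⟩

theorem values_finite (hV : V(G).Finite) (hE : E(G).Finite) : f.values.Finite :=
  (hV.image _).union (hE.image _)

theorem contractedVerts_eq {j j' : ℕ} (h : min j (f.lastStep + 1) = min j' (f.lastStep + 1)) :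
    f.contractedVerts j = f.contractedVerts j' := by
  ext x
  refine exists_congr fun i => and_congr_right fun hi => ?_
  rw [show f.lastStep < i + j ↔ f.lastStep < i + j' by omega]

theorem contractedEdges_eq {j j' : ℕ} (h : min j (f.lastStep + 1) = min j' (f.lastStep + 1)) :
    f.contractedEdges j = f.contractedEdges j' := by
  ext x
  refine exists_congr fun i => and_congr_right fun hi => ?_
  rw [show f.lastStep < i + j ↔ f.lastStep < i + j' by omega]

theorem stage_eq (hf : f.values.Finite) {i i' j j' : ℕ}
    (hi : min i f.lastStep = min i' f.lastStep)
    (hj : min j (f.lastStep + 1) = min j' (f.lastStep + 1)) : f.stage i j = f.stage i' j' := by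
  have key : ∀ t ∈ f.values, (f.step t ≤ i ↔ f.step t ≤ i') := by
    intro t ht
    have := f.step_le_lastStep hf ht
    omega
  refine Graph.ext (Set.ext fun a => ?_) fun e a b => ?_
  · rw [mem_stage_vertexSet, mem_stage_vertexSet, f.contractedVerts_eq hj]
    exact exists_congr fun x => and_congr_right fun hx => by rw [key _ (Or.inl ⟨x, hx, rfl⟩)]
  · rw [stage_isLink, stage_isLink, f.contractedVerts_eq hj, f.contractedEdges_eq hj]
    refine exists_congr fun x => exists_congr fun y => and_congr_right fun h => ?_
    rw [key _ (Or.inl ⟨x, h.left_mem, rfl⟩), key _ (Or.inl ⟨y, h.right_mem, rfl⟩),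
      key _ (Or.inr ⟨e, h.edge_mem, rfl⟩)]

theorem homologyRank_stageMap_congr (hf : f.values.Finite) {i₁ i₂ j₁ j₂ i₁' i₂' j₁' j₂' : ℕ}
    (hi : i₁ ≤ i₂) (hj : j₁ ≤ j₂) (hi' : i₁' ≤ i₂') (hj' : j₁' ≤ j₂')
    (h₁ : min i₁ f.lastStep = min i₁' f.lastStep) (h₂ : min i₂ f.lastStep = min i₂' f.lastStep)
    (h₃ : j₁ = j₁') (h₄ : j₂ = j₂') (k : ℕ) :
    (f.stageMap hi hj).homologyRank k = (f.stageMap hi' hj').homologyRank k := by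
  subst h₃ h₄
  exact CellMap.homologyRank_congr (f.stage_eq hf h₁ rfl) (f.stage_eq hf h₂ rfl)
    (fun _ _ => rfl) k

theorem surjective_pathSequence_map (hf : f.values.Finite) {a b : ℕ → ℕ} (ha : Monotone a)
    (hb : Monotone b) {t : ℕ} (hat : f.lastStep ≤ a t)
    (hbt : b t = b (t + 1) ∨ f.lastStep < b t) (k : ℕ) :
    Function.Surjective (((f.pathSequence ha hb).persistentHomology k).map t) := by
  have h1 := ha t.le_succ
  have h2 := hb t.le_succ
  simp only [Nat.succ_eq_add_one] at h1 h2
  have hb' : min (b t) (f.lastStep + 1) = min (b (t + 1)) (f.lastStep + 1) := by omega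
  refine GraphSequence.surjective_persistentHomology_map (f.stage_eq hf (by omega) hb')
    (fun x hx => ?_) k
  change x.bind (collapse (f.contractedVerts (b (t + 1)))) = x
  rw [← f.contractedVerts_eq hb']
  exact f.stageMap_onVert_self hx

/-- Beyond `T` the path no longer changes the stage: the sublevel is already `G`, and the
contractions have either stopped or all been performed. So the diagram is characterised by its
counts. -/
theorem isPersistenceDiagram_pathSequence_iff (hV : V(G).Finite) (hE : E(G).Finite)
    {a b : ℕ → ℕ} (ha : Monotone a) (hb : Monotone b) {T : ℕ} (haT : f.lastStep ≤ a T)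
    (hbT : ∀ t, T ≤ t → b t = b (t + 1) ∨ f.lastStep < b t) {k : ℕ} {D : Diagram} :
    IsPersistenceDiagram ((f.pathSequence ha hb).persistentHomology k) D ↔
      (∀ p ∈ D, (p.1 : ℕ∞) < p.2) ∧ ∀ (s t : ℕ) (h : s ≤ t),
        D.countP (fun p => p.1 ≤ s ∧ (t : ℕ∞) < p.2) =
          (f.stageMap (ha h) (hb h)).homologyRank k := by
  have hf := f.values_finite hV hE
  have := GraphSequence.finite_persistentHomology (S := f.pathSequence ha hb)
    (fun _ => f.stage_vertexSet_finite hV _ _) (fun _ => hE.subset (f.stage_edgeSet_subset _ _)) k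
  constructor
  · intro h
    refine ⟨fun p hp => h.lt_of_mem hp, fun s t hst => ?_⟩
    rw [h.countP_eq_rank hst, f.rank_pathSequence ha hb hst]
  · rintro ⟨h1, h2⟩
    refine isPersistenceDiagram_of_rank (fun t ht => f.surjective_pathSequence_map hf ha hb
      (haT.trans (ha ht)) (hbT t ht) k) h1 fun s t hst => ?_
    rw [h2 s t hst, f.rank_pathSequence ha hb hst]

theorem exists_isPersistenceDiagram_pathSequence (hV : V(G).Finite) (hE : E(G).Finite)
    {a b : ℕ → ℕ} (ha : Monotone a) (hb : Monotone b) {T : ℕ} (haT : f.lastStep ≤ a T)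
    (hbT : ∀ t, T ≤ t → b t = b (t + 1) ∨ f.lastStep < b t) (k : ℕ) :
    ∃ D, IsPersistenceDiagram ((f.pathSequence ha hb).persistentHomology k) D := by
  have hf := f.values_finite hV hE
  have := GraphSequence.finite_persistentHomology (S := f.pathSequence ha hb)
    (fun _ => f.stage_vertexSet_finite hV _ _) (fun _ => hE.subset (f.stage_edgeSet_subset _ _)) k
  exact PersistenceModule.exists_isPersistenceDiagram fun t ht =>
    f.surjective_pathSequence_map hf ha hb (haT.trans (ha ht)) (hbT t ht) k

theorem monotone_tsub (n : ℕ) : Monotone fun t : ℕ => t - n :=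
  fun _ _ h => Nat.sub_le_sub_right h n

theorem forward_eq : f.forward = f.pathSequence monotone_id (monotone_const (c := 0)) := rfl

theorem backward_eq :
    f.backward = f.pathSequence (monotone_const (c := f.lastStep)) monotone_id := rfl

theorem forwardBackward_eq :
    f.forwardBackward = f.pathSequence monotone_id (monotone_tsub f.lastStep) := rfl

end FiltrationFunction

/-! ### Forward-backward diagrams determine forward and backward diagrams -/

namespace Diagram

theorem countP_map_filter (D : Diagram) (g : ℕ × ℕ∞ → ℕ × ℕ∞) (p q r : ℕ × ℕ∞ → Prop)
    [DecidablePred p] [DecidablePred q] [DecidablePred r]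
    (h : ∀ x, (p (g x) ∧ q x) ↔ r x) : ((D.filter q).map g).countP p = D.countP r := by
  rw [Multiset.countP_map, ← Multiset.countP_eq_card_filter, Multiset.countP_filter]
  exact Multiset.countP_congr rfl fun x _ => propext (h x)

/-- The forward diagram read off a forward-backward diagram: intervals born after time `n` are
dropped, and classes alive at time `n` survive forever. -/
noncomputable def truncate (n : ℕ) (D : Diagram) : Diagram :=
  (D.filter fun p => p.1 ≤ n).map fun p => (p.1, if p.2 ≤ (n : ℕ∞) then p.2 else ⊤)

/-- The backward diagram read off a forward-backward diagram: intervals are cut to the times from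
`n` on, and shifted by `n`. -/
noncomputable def shift (n : ℕ) (D : Diagram) : Diagram :=
  (D.filter fun p => (n : ℕ∞) < p.2).map fun p => (p.1 - n, p.2 - n)

theorem lt_of_mem_truncate {n : ℕ} {D : Diagram} (hD : ∀ p ∈ D, (p.1 : ℕ∞) < p.2) :
    ∀ p ∈ D.truncate n, (p.1 : ℕ∞) < p.2 := by
  intro p hp
  obtain ⟨q, hq, rfl⟩ := Multiset.mem_map.1 hp
  have := hD q (Multiset.mem_filter.1 hq).1
  dsimp only
  split_ifs
  · exact this
  · exact ENat.natCast_lt_top _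

theorem lt_of_mem_shift {n : ℕ} {D : Diagram} (hD : ∀ p ∈ D, (p.1 : ℕ∞) < p.2) :
    ∀ p ∈ D.shift n, (p.1 : ℕ∞) < p.2 := by
  intro p hp
  obtain ⟨⟨b, d⟩, hq, rfl⟩ := Multiset.mem_map.1 hp
  have h1 := hD _ (Multiset.mem_filter.1 hq).1
  have h2 := (Multiset.mem_filter.1 hq).2
  induction d using ENat.recTopCoe with
  | top => exact WithTop.coe_lt_top (b - n)
  | coe d =>
    dsimp only at h1 h2 ⊢
    norm_cast at h1 h2 ⊢
    omega

theorem countP_truncate (n : ℕ) (D : Diagram) (i j : ℕ) :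
    (D.truncate n).countP (fun p => p.1 ≤ i ∧ (j : ℕ∞) < p.2) =
      D.countP (fun p => p.1 ≤ min i n ∧ ((min j n : ℕ) : ℕ∞) < p.2) := by
  refine countP_map_filter _ _ _ _ _ fun ⟨b, d⟩ => ?_
  induction d using ENat.recTopCoe with
  | top => simp
  | coe d =>
    dsimp only
    split_ifs with h
    · norm_cast at h ⊢
      omega
    · norm_cast at h ⊢
      simp only [ENat.natCast_lt_top, and_true]
      omega

theorem countP_shift (n : ℕ) (D : Diagram) (i j : ℕ) :
    (D.shift n).countP (fun p => p.1 ≤ i ∧ (j : ℕ∞) < p.2) =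
      D.countP (fun p => p.1 ≤ n + i ∧ ((n + j : ℕ) : ℕ∞) < p.2) := by
  refine countP_map_filter _ _ _ _ _ fun ⟨b, d⟩ => ?_
  induction d using ENat.recTopCoe with
  | top => simp; omega
  | coe d =>
    dsimp only
    norm_cast
    omega

end Diagram

namespace FiltrationFunction

variable {α β : Type u} {G : Graph α β} (f : FiltrationFunction G)

theorem exists_isPersistenceDiagram_forwardBackward (hV : V(G).Finite) (hE : E(G).Finite) (k : ℕ) :
    ∃ D, IsPersistenceDiagram (f.forwardBackward.persistentHomology k) D :=
  -- The last contraction, number `n + 1`, takes place at time `n + (n + 1)`.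
  f.exists_isPersistenceDiagram_pathSequence hV hE monotone_id (monotone_tsub _) (T := 2 * f.lastStep + 1)
    (by change f.lastStep ≤ 2 * f.lastStep + 1; omega) (fun t ht => by omega) k

theorem isPersistenceDiagram_forward (hV : V(G).Finite) (hE : E(G).Finite) {k : ℕ} {D : Diagram}
    (h : IsPersistenceDiagram (f.forwardBackward.persistentHomology k) D) :
    IsPersistenceDiagram (f.forward.persistentHomology k) (D.truncate f.lastStep) := by
  have hf := f.values_finite hV hE
  rw [forwardBackward_eq, f.isPersistenceDiagram_pathSequence_iff hV hE _ _
    (T := 2 * f.lastStep + 1) (by change f.lastStep ≤ 2 * f.lastStep + 1; omega) (fun t ht => by omega)] at h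
  rw [forward_eq, f.isPersistenceDiagram_pathSequence_iff hV hE _ _
    (T := f.lastStep) le_rfl (fun t ht => Or.inl rfl)]
  refine ⟨Diagram.lt_of_mem_truncate h.1, fun s t hst => ?_⟩
  -- Both times are now at most `n`, where truncated subtraction gives no contractions.
  rw [Diagram.countP_truncate, h.2 _ _ (by omega)]
  apply f.homologyRank_stageMap_congr hf <;> simp

theorem isPersistenceDiagram_backward (hV : V(G).Finite) (hE : E(G).Finite) {k : ℕ} {D : Diagram}
    (h : IsPersistenceDiagram (f.forwardBackward.persistentHomology k) D) :
    IsPersistenceDiagram (f.backward.persistentHomology k) (D.shift f.lastStep) := by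
  have hf := f.values_finite hV hE
  rw [forwardBackward_eq, f.isPersistenceDiagram_pathSequence_iff hV hE _ _
    (T := 2 * f.lastStep + 1) (by change f.lastStep ≤ 2 * f.lastStep + 1; omega) (fun t ht => by omega)] at h
  rw [backward_eq, f.isPersistenceDiagram_pathSequence_iff hV hE _ _
    (T := f.lastStep + 1) le_rfl (fun t ht => Or.inr ht)]
  refine ⟨Diagram.lt_of_mem_shift h.1, fun s t hst => ?_⟩
  -- At time `n + t` exactly `t` contractions have been made, and the sublevel index `n + t` gives
  -- the same stage as `n`.
  rw [Diagram.countP_shift, h.2 _ _ (by omega)]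
  apply f.homologyRank_stageMap_congr hf <;> simp

end FiltrationFunction

/-! ### Persistence modules whose structure maps are all surjective, or all injective -/

namespace PersistenceModule

variable {M M' : PersistenceModule.{u}}

theorem rank_of_surjective (h : ∀ i, Function.Surjective (M.map i)) {i j : ℕ} (hij : i ≤ j) :
    M.rank i j = Module.finrank (ZMod 2) (M.space j) := by
  have hs : Function.Surjective (M.trans i j) := by
    induction j, hij using Nat.le_induction with
    | base => rw [trans_self]; exact Function.surjective_id
    | succ j hj ih => rw [trans_succ _ hj]; exact (h j).comp ih
  rw [rank, LinearMap.range_eq_top.2 hs, finrank_top]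

theorem rank_of_injective (h : ∀ i, Function.Injective (M.map i)) {i j : ℕ} (hij : i ≤ j) :
    M.rank i j = Module.finrank (ZMod 2) (M.space i) := by
  have hs : Function.Injective (M.trans i j) := by
    induction j, hij using Nat.le_induction with
    | base => rw [trans_self]; exact Function.injective_id
    | succ j hj ih => rw [trans_succ _ hj]; exact (h j).comp ih
  exact LinearMap.finrank_range_of_inj hs

theorem exists_common_diagram_of_rank [∀ i, Finite (M.space i)] [∀ i, Finite (M'.space i)] {T : ℕ}
    (hT : ∀ i, T ≤ i → Function.Surjective (M.map i))
    (hT' : ∀ i, T ≤ i → Function.Surjective (M'.map i))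
    (h : ∀ i j, i ≤ j → M.rank i j = M'.rank i j) :
    ∃ D, IsPersistenceDiagram M D ∧ IsPersistenceDiagram M' D := by
  obtain ⟨D, hD⟩ := exists_isPersistenceDiagram hT
  exact ⟨D, hD, isPersistenceDiagram_of_rank hT' (fun _ => hD.lt_of_mem) fun i j hij => by
    rw [hD.countP_eq_rank hij, h i j hij]⟩

end PersistenceModule

section Homology

variable {α β : Type u} {X Y : Graph α β}

/-! ### Dimensions of graph homology -/

/-- Signs are immaterial modulo 2; the difference form telescopes along paths and cycles. -/
theorem edgeBoundary_eq_sub {e : β} {x y : α} (h : X.IsLink e x y) :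
    edgeBoundary X e = Finsupp.single x 1 - Finsupp.single y 1 := by
  rw [edgeBoundary_eq h, sub_eq_add_neg, ← Finsupp.single_neg]
  rfl

theorem boundary_single (e : β) : boundary X (Finsupp.single e 1) = edgeBoundary X e := by
  simp [boundary]

theorem single_mem_chains₁ {e : β} (he : e ∈ E(X)) : Finsupp.single e (1 : ZMod 2) ∈ chains₁ X :=
  Finsupp.single_mem_supported _ _ he

theorem single_mem_chains₀ {x : α} (hx : x ∈ V(X)) : Finsupp.single x (1 : ZMod 2) ∈ chains₀ X :=
  Finsupp.single_mem_supported _ _ hx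

theorem boundary_mem_chains₀ {c : β →₀ ZMod 2} (hc : c ∈ chains₁ X) :
    boundary X c ∈ chains₀ X := by
  have h : chains₁ X ≤ (chains₀ X).comap (boundary X) := by
    rw [chains₁, Finsupp.supported_eq_span_single, Submodule.span_le]
    rintro _ ⟨e, he, rfl⟩
    obtain ⟨x, y, hxy⟩ := Graph.exists_isLink_of_mem_edgeSet he
    change boundary X (Finsupp.single e 1) ∈ chains₀ X
    rw [boundary_single, edgeBoundary_eq hxy]
    exact Submodule.add_mem _ (single_mem_chains₀ hxy.left_mem) (single_mem_chains₀ hxy.right_mem)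
  exact h hc

theorem finrank_supported {γ : Type*} (s : Set γ) :
    Module.finrank (ZMod 2) (Finsupp.supported (ZMod 2) (ZMod 2) s) = s.ncard := by
  rw [(Finsupp.supportedEquivFinsupp (R := ZMod 2) (M := ZMod 2) s).finrank_eq, Set.ncard]
  by_cases hs : s.Finite
  · have := hs.fintype
    rw [Module.finrank_finsupp_self, ← Nat.card_eq_fintype_card]
    rfl
  -- For infinite `s` both sides take the default value `0`.
  · have := Set.Infinite.to_subtype hs
    rw [Module.finrank_of_not_finite, Set.Infinite.encard_eq hs]
    · rfl
    · rw [Module.finite_finsupp_self_iff]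
      exact fun h => h.elim (not_subsingleton _) (not_finite_iff_infinite.2 this)

/-- The Euler characteristic formula. -/
theorem finrank_H₁_add_ncard (hV : V(X).Finite) (hE : E(X).Finite) :
    Module.finrank (ZMod 2) (H₁ X) + V(X).ncard =
      E(X).ncard + Module.finrank (ZMod 2) (H₀ X) := by
  have : Finite (chains₀ X) := finite_supported hV
  have : Finite (chains₁ X) := finite_supported hE
  let d : chains₁ X →ₗ[ZMod 2] chains₀ X := (boundary X).restrict fun _ => boundary_mem_chains₀
  have hker : Module.finrank (ZMod 2) (LinearMap.ker d) = Module.finrank (ZMod 2) (H₁ X) := by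
    have h : (LinearMap.ker d).map (chains₁ X).subtype = cycles₁ X := by
      ext c
      constructor
      · rintro ⟨⟨c, hc⟩, h, rfl⟩
        exact ⟨hc, congrArg Subtype.val (LinearMap.mem_ker.1 h)⟩
      · rintro ⟨hc, h⟩
        exact ⟨⟨c, hc⟩, LinearMap.mem_ker.2 (Subtype.ext h), rfl⟩
    rw [← Submodule.finrank_map_subtype_eq, h]
  have hrange : LinearMap.range d = boundaries₀ X := by
    ext c
    constructor
    · rintro ⟨⟨b, hb⟩, rfl⟩
      exact ⟨b, hb, rfl⟩
    · rintro ⟨b, hb, h⟩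
      exact ⟨⟨b, hb⟩, Subtype.ext h⟩
  have h1 := d.finrank_range_add_finrank_ker
  have h2 := Submodule.finrank_quotient_add_finrank (boundaries₀ X)
  have h3 : Module.finrank (ZMod 2) (chains₁ X) = E(X).ncard := finrank_supported _
  have h4 : Module.finrank (ZMod 2) (chains₀ X) = V(X).ncard := finrank_supported _
  rw [hker, hrange] at h1
  change Module.finrank (ZMod 2) (H₁ X) + V(X).ncard =
    E(X).ncard + Module.finrank (ZMod 2) (chains₀ X ⧸ boundaries₀ X)
  omega

theorem sub_mapDomain_mem {B : Submodule (ZMod 2) (α →₀ ZMod 2)} {s : α → α}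
    (h : ∀ x ∈ V(X), Finsupp.single x 1 - Finsupp.single (s x) 1 ∈ B) {c : α →₀ ZMod 2}
    (hc : c ∈ chains₀ X) : c - Finsupp.mapDomain s c ∈ B := by
  have h' : chains₀ X ≤ B.comap (LinearMap.id - Finsupp.lmapDomain (ZMod 2) (ZMod 2) s) := by
    rw [chains₀, Finsupp.supported_eq_span_single, Submodule.span_le]
    rintro _ ⟨x, hx, rfl⟩
    simpa [Finsupp.mapDomain_single] using h x hx
  exact h' hc

theorem single_sub_single_mem_of_reflTransGen {x y : α} (h : Relation.ReflTransGen X.Adj x y) :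
    Finsupp.single x 1 - Finsupp.single y 1 ∈ (chains₁ X).map (boundary X) := by
  induction h with
  | refl => simp
  | @tail y z _ hyz ih =>
    obtain ⟨e, he⟩ := hyz
    rw [← sub_add_sub_cancel _ (Finsupp.single y 1)]
    exact Submodule.add_mem _ ih ⟨Finsupp.single e 1, single_mem_chains₁ he.edge_mem, by
      rw [boundary_single, edgeBoundary_eq_sub he]⟩

/-- If `r` picks a vertex in every connected component, the number of picked vertices is the
dimension of `H₀`. -/
theorem finrank_H₀_eq_ncard {r : α → α} (hr : ∀ x ∈ V(X), r x ∈ V(X))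
    (hlink : ∀ e x y, X.IsLink e x y → r x = r y)
    (hpath : ∀ x ∈ V(X), Relation.ReflTransGen X.Adj x (r x)) :
    Module.finrank (ZMod 2) (H₀ X) = (r '' V(X)).ncard := by
  have hrr : ∀ x ∈ V(X), r (r x) = r x := by
    intro x hx
    have key : ∀ y, Relation.ReflTransGen X.Adj x y → r y = r x := by
      intro y h
      induction h with
      | refl => rfl
      | tail _ hyz ih => obtain ⟨e, he⟩ := hyz; rw [← ih, hlink _ _ _ he]
    exact key _ (hpath x hx)
  have hmem : ∀ c ∈ chains₀ X,
      Finsupp.lmapDomain (ZMod 2) (ZMod 2) r c ∈ Finsupp.supported (ZMod 2) (ZMod 2) (r '' V(X)) := by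
    intro c hc
    have h := Submodule.mem_map_of_mem (f := Finsupp.lmapDomain (ZMod 2) (ZMod 2) r) hc
    rwa [chains₀, Finsupp.lmapDomain_supported] at h
  let p : chains₀ X →ₗ[ZMod 2] Finsupp.supported (ZMod 2) (ZMod 2) (r '' V(X)) :=
    (Finsupp.lmapDomain (ZMod 2) (ZMod 2) r).restrict hmem
  -- A chain differs from its image under `r` by a boundary, since every vertex is joined to its
  -- representative; conversely `r` kills the boundary of each edge.
  have hker : LinearMap.ker p = boundaries₀ X := by
    ext ⟨c, hc⟩
    constructor
    · intro h
      have h0 : Finsupp.mapDomain r c = 0 := congrArg Subtype.val (LinearMap.mem_ker.1 h)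
      have := sub_mapDomain_mem
        (fun x hx => single_sub_single_mem_of_reflTransGen (hpath x hx)) hc
      rwa [h0, sub_zero] at this
    · rintro ⟨b, hb, hbc⟩
      refine LinearMap.mem_ker.2 (Subtype.ext ?_)
      change Finsupp.mapDomain r c = 0
      change boundary X b = c at hbc
      rw [← hbc]
      have h : chains₁ X ≤
          LinearMap.ker (Finsupp.lmapDomain (ZMod 2) (ZMod 2) r ∘ₗ boundary X) := by
        rw [chains₁, Finsupp.supported_eq_span_single, Submodule.span_le]
        rintro _ ⟨e, he, rfl⟩
        obtain ⟨x, y, hxy⟩ := Graph.exists_isLink_of_mem_edgeSet he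
        change Finsupp.lmapDomain (ZMod 2) (ZMod 2) r (boundary X (Finsupp.single e 1)) = 0
        rw [boundary_single, edgeBoundary_eq_sub hxy, map_sub]
        simp [Finsupp.mapDomain_single, hlink _ _ _ hxy]
      exact h hb
  have hsurj : Function.Surjective p := by
    rintro ⟨c, hc⟩
    have hc' : c ∈ chains₀ X := Finsupp.supported_mono (by
      rintro _ ⟨x, hx, rfl⟩
      exact hr x hx) hc
    refine ⟨⟨c, hc'⟩, Subtype.ext ?_⟩
    change Finsupp.mapDomain r c = c
    conv_rhs => rw [← Finsupp.mapDomain_id (v := c)]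
    refine Finsupp.mapDomain_congr fun x hx => ?_
    obtain ⟨y, hy, rfl⟩ := (Finsupp.mem_supported _ _).1 hc hx
    exact hrr y hy
  rw [← finrank_supported, ← (LinearMap.quotKerEquivOfSurjective p hsurj).finrank_eq, hker]

/-! ### Criteria for injectivity and surjectivity on homology -/

namespace CellMap

variable (φ : CellMap X Y)

theorem onH₀_surjective (h : ∀ y ∈ V(Y), ∃ x ∈ V(X), φ.onVert x = y ∨ Y.Adj (φ.onVert x) y) :
    Function.Surjective φ.onH₀ := by
  have key : ∀ y (hy : y ∈ V(Y)), ∃ c ∈ chains₀ X,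
      Finsupp.single y 1 - φ.map₀ c ∈ (chains₁ Y).map (boundary Y) := by
    intro y hy
    obtain ⟨x, hx, hxy⟩ := h y hy
    refine ⟨Finsupp.single x 1, single_mem_chains₀ hx, ?_⟩
    rw [map₀, Finsupp.lmapDomain_apply, Finsupp.mapDomain_single]
    refine single_sub_single_mem_of_reflTransGen ?_
    rcases hxy with rfl | hxy
    · exact Relation.ReflTransGen.refl
    · exact Relation.ReflTransGen.single hxy.symm
  have hle : chains₀ Y ≤ (chains₀ X).map φ.map₀ ⊔ (chains₁ Y).map (boundary Y) := by
    rw [chains₀, Finsupp.supported_eq_span_single, Submodule.span_le]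
    rintro _ ⟨y, hy, rfl⟩
    obtain ⟨c, hc, hcy⟩ := key y hy
    exact Submodule.mem_sup.2 ⟨_, ⟨c, hc, rfl⟩, _, hcy, add_sub_cancel _ _⟩
  intro a
  obtain ⟨⟨c, hc⟩, rfl⟩ := Submodule.mkQ_surjective (boundaries₀ Y) a
  obtain ⟨_, ⟨b, hb, rfl⟩, d, hd, hbd⟩ := Submodule.mem_sup.1 (hle hc)
  refine ⟨Submodule.Quotient.mk ⟨b, hb⟩, (Submodule.Quotient.eq _).2 ?_⟩
  change φ.map₀ b - c ∈ (chains₁ Y).map (boundary Y)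
  rw [← hbd, sub_add_cancel_left]
  exact Submodule.neg_mem _ hd

theorem onH₁_injective (h : E(X) ⊆ E(Y)) : Function.Injective φ.onH₁ := by
  classical
  intro c d hcd
  refine Subtype.ext (Finsupp.ext fun e => ?_)
  by_cases he : e ∈ E(Y)
  · have := congrArg (fun z : H₁ Y => z.1 e) hcd
    simpa [onH₁_apply, he] using this
  · have key : ∀ c : H₁ X, c.1 e = 0 := fun c => by
      by_contra h0
      exact he (h ((Finsupp.mem_supported _ _).1 c.2.1 (Finsupp.mem_support_iff.2 h0)))
    rw [key, key]

/-- Read a cycle `c` of `Y` as a chain of `X`. Its boundary maps to `0` in `Y`, and `hs` says that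
each vertex agrees with a chosen lift of its image up to boundaries of collapsed chains. So `∂c =
∂d` with `d` collapsed, and `c - d` is a cycle of `X` that maps to `c`. -/
theorem onH₁_surjective (hE : E(Y) ⊆ E(X)) {s : α → α}
    (hs : ∀ x ∈ V(X), Finsupp.single x 1 - Finsupp.single (s (φ.onVert x)) 1 ∈
      (chains₁ X ⊓ LinearMap.ker φ.map₁).map (boundary X)) :
    Function.Surjective φ.onH₁ := by
  classical
  rintro ⟨c, hc, hc0⟩
  have hcX : c ∈ chains₁ X := Finsupp.supported_mono hE hc
  have hcc : φ.map₁ c = c := by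
    ext e
    rw [map₁_apply]
    split_ifs with he
    · rfl
    · by_contra h
      exact he ((Finsupp.mem_supported _ _).1 hc (Finsupp.mem_support_iff.2 (Ne.symm h)))
  have h0 : φ.map₀ (boundary X c) = 0 := by
    rw [← φ.boundary_map₁ hcX, hcc]
    exact hc0
  have h1 := sub_mapDomain_mem (s := s ∘ φ.onVert) hs (boundary_mem_chains₀ hcX)
  rw [Finsupp.mapDomain_comp, show Finsupp.mapDomain φ.onVert (boundary X c) = 0 from h0,
    Finsupp.mapDomain_zero, sub_zero] at h1
  obtain ⟨d, ⟨hd, hd0⟩, hdc⟩ := h1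
  refine ⟨⟨c - d, Submodule.sub_mem _ hcX hd, ?_⟩, Subtype.ext ?_⟩
  · change boundary X (c - d) = 0
    rw [map_sub, hdc, sub_self]
  · change φ.map₁ (c - d) = c
    rw [map_sub, hcc, LinearMap.mem_ker.1 hd0, sub_zero]

theorem homologyRank_one_ne_zero (hE : E(Y).Finite) {c : β →₀ ZMod 2} (hc : c ∈ cycles₁ X)
    {e : β} (he : e ∈ E(Y)) (hce : c e ≠ 0) : φ.homologyRank 1 ≠ 0 := by
  classical
  have := finite_H₁ hE
  intro h
  have h' := LinearMap.mem_range_self φ.onH₁ ⟨c, hc⟩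
  rw [Submodule.finrank_eq_zero.1 h, Submodule.mem_bot] at h'
  refine hce ?_
  simpa [onH₁_apply, he] using congrArg (fun z : H₁ Y => z.1 e) h'

theorem homologyRank_one_eq_zero (h : ∀ c ∈ cycles₁ X, ∀ e ∈ E(Y), c e = 0) :
    φ.homologyRank 1 = 0 := by
  classical
  have h0 : φ.onH₁ = 0 := LinearMap.ext fun c => Subtype.ext (Finsupp.ext fun e => by
    rw [onH₁_apply]
    split_ifs with he
    · exact h c.1 c.2 e he
    · rfl)
  rw [homologyRank, h0, LinearMap.range_zero, finrank_bot]

end CellMap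

/-- A cycle vanishes on an edge that has an end of degree one. -/
theorem eq_zero_of_mem_cycles₁ {c : β →₀ ZMod 2} (hc : c ∈ cycles₁ X) {e : β} {x y : α}
    (hxy : X.IsLink e x y) (hne : x ≠ y) (h : ∀ e', X.Inc e' x → e' = e) : c e = 0 := by
  classical
  -- Only `e` meets `x`, and it is not a loop, so the coefficient of `∂c` at `x` is the coefficient
  -- of `c` at `e`.
  have key : chains₁ X ≤ LinearMap.eqLocus (Finsupp.lapply x ∘ₗ boundary X)
      (Finsupp.lapply (R := ZMod 2) e) := by
    rw [chains₁, Finsupp.supported_eq_span_single, Submodule.span_le]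
    rintro _ ⟨e', he', rfl⟩
    change boundary X (Finsupp.single e' 1) x = Finsupp.single e' 1 e
    rw [boundary_single]
    by_cases hee : e' = e
    · subst hee
      rw [edgeBoundary_eq hxy]
      simp [hne.symm]
    · obtain ⟨a, b, hab⟩ := Graph.exists_isLink_of_mem_edgeSet he'
      have ha : a ≠ x := fun h' => hee (h e' (h' ▸ hab.inc_left))
      have hb : b ≠ x := fun h' => hee (h e' (h' ▸ hab.inc_right))
      rw [edgeBoundary_eq hab]
      simp [ha, hb, hee]
  have h1 := key hc.1
  have h2 : boundary X c x = c e := h1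
  rw [← h2, LinearMap.mem_ker.1 hc.2, Finsupp.zero_apply]

end Homology

/-! ### Common diagrams of two modules -/

namespace PersistenceModule

variable {M M' : PersistenceModule.{u}}

theorem exists_common_diagram_of_surjective [∀ i, Finite (M.space i)] [∀ i, Finite (M'.space i)]
    (hM : ∀ i, Function.Surjective (M.map i)) (hM' : ∀ i, Function.Surjective (M'.map i))
    (h : ∀ i, Module.finrank (ZMod 2) (M.space i) = Module.finrank (ZMod 2) (M'.space i)) :
    ∃ D, IsPersistenceDiagram M D ∧ IsPersistenceDiagram M' D :=
  exists_common_diagram_of_rank (T := 0) (fun i _ => hM i) (fun i _ => hM' i) fun i j hij => by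
    rw [rank_of_surjective hM hij, rank_of_surjective hM' hij, h]

theorem exists_common_diagram_of_injective [∀ i, Finite (M.space i)] [∀ i, Finite (M'.space i)]
    {T : ℕ} (hT : ∀ i, T ≤ i → Function.Surjective (M.map i))
    (hT' : ∀ i, T ≤ i → Function.Surjective (M'.map i))
    (hM : ∀ i, Function.Injective (M.map i)) (hM' : ∀ i, Function.Injective (M'.map i))
    (h : ∀ i, Module.finrank (ZMod 2) (M.space i) = Module.finrank (ZMod 2) (M'.space i)) :
    ∃ D, IsPersistenceDiagram M D ∧ IsPersistenceDiagram M' D :=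
  exists_common_diagram_of_rank hT hT' fun i j hij => by
    rw [rank_of_injective hM hij, rank_of_injective hM' hij, h]

end PersistenceModule

theorem GraphSequence.exists_common_diagram_of_two_le {α β : Type u} (S S' : GraphSequence α β)
    (k : ℕ) : ∃ D, IsPersistenceDiagram (S.persistentHomology (k + 2)) D ∧
      IsPersistenceDiagram (S'.persistentHomology (k + 2)) D := by
  have : ∀ i, Finite ((S.persistentHomology (k + 2)).space i) :=
    fun _ => inferInstanceAs (Finite PUnit)
  have : ∀ i, Finite ((S'.persistentHomology (k + 2)).space i) :=
    fun _ => inferInstanceAs (Finite PUnit)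
  exact PersistenceModule.exists_common_diagram_of_surjective (fun _ x => ⟨x, rfl⟩)
    (fun _ x => ⟨x, rfl⟩) fun _ => rfl

theorem single_sub_single_mem_of_isLink {α β : Type u} {X Y : Graph α β} (φ : CellMap X Y) {e : β}
    {x y : α} (h : X.IsLink e x y) (he : e ∉ E(Y)) :
    Finsupp.single x 1 - Finsupp.single y 1 ∈
      (chains₁ X ⊓ LinearMap.ker φ.map₁).map (boundary X) := by
  classical
  refine ⟨Finsupp.single e 1, ⟨single_mem_chains₁ h.edge_mem, ?_⟩, by
    rw [boundary_single, edgeBoundary_eq_sub h]⟩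
  change φ.map₁ (Finsupp.single e 1) = 0
  ext e'
  rw [CellMap.map₁_apply]
  split_ifs with he'
  · have hne : e ≠ e' := fun hh => he (hh ▸ he')
    simp [hne]
  · rfl

/-! ### Graphs with seven vertices and nine edges with prescribed degrees -/

/-- The graph whose vertices and edges are all elements of `α` and `β`, where `t e` is the pair of
ends of `e`. -/
def ofEnds {α β : Type*} (t : β → α × α) : Graph α β where
  vertexSet := Set.univ
  edgeSet := Set.univ
  IsLink e x y := t e = (x, y) ∨ t e = (y, x)
  isLink_symm _ _ := ⟨fun _ _ h => h.symm⟩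
  eq_or_eq_of_isLink_of_isLink := by
    rintro e x y v w (h | h) (h' | h') <;> rw [h, Prod.mk.injEq] at h' <;> tauto
  edge_mem_iff_exists_isLink e := by
    simp only [Set.mem_univ, true_iff]
    exact ⟨_, _, Or.inl rfl⟩
  left_mem_of_isLink _ _ _ _ := Set.mem_univ _

/-- The level of a vertex: its degree minus `2`. -/
def vertexLevel : Fin 7 → ℕ := ![1, 0, 0, 0, 1, 0, 2]

/-- The level of an edge: the maximum of the levels of its ends. -/
def edgeLevel : Fin 9 → ℕ := ![0, 1, 1, 1, 1, 2, 2, 2, 2]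

theorem vertexLevel_le (x : Fin 7) : vertexLevel x ≤ 2 := by
  revert x; decide

theorem edgeLevel_le (e : Fin 9) : edgeLevel e ≤ 2 := by
  revert e; decide

/-- The ends of the edges are compatible with the levels. -/
def IsLevelled (t : Fin 9 → Fin 7 × Fin 7) : Prop :=
  ∀ e, edgeLevel e = max (vertexLevel (t e).1) (vertexLevel (t e).2)

/-- The filtration given by the levels. -/
noncomputable def levelFiltration {t : Fin 9 → Fin 7 × Fin 7} (h : IsLevelled t) :
    FiltrationFunction (ofEnds t) where
  onVert x := vertexLevel x + 2
  onEdge e := edgeLevel e + 2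
  le_of_inc := by
    rintro e x ⟨y, hxy⟩
    have : vertexLevel x ≤ edgeLevel e := by
      rw [h e]
      rcases hxy with hxy | hxy <;> rw [hxy]
      · exact le_max_left _ _
      · exact le_max_right _ _
    simpa using this

/-- The vertex `x` lies in a part contracted in the first `j` steps. -/
def IsContracted (t : Fin 9 → Fin 7 × Fin 7) (j : ℕ) (x : Fin 7) : Prop :=
  2 < vertexLevel x + j ∨ ∃ e, 2 < edgeLevel e + j ∧ ((t e).1 = x ∨ (t e).2 = x)

instance (t : Fin 9 → Fin 7 × Fin 7) (j : ℕ) : DecidablePred (IsContracted t j) :=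
  fun x => inferInstanceAs (Decidable (2 < vertexLevel x + j ∨
    ∃ e, 2 < edgeLevel e + j ∧ ((t e).1 = x ∨ (t e).2 = x)))

/-- The image of a vertex after `j` contractions. -/
def contraction (t : Fin 9 → Fin 7 × Fin 7) (j : ℕ) (x : Fin 7) : Option (Fin 7) :=
  if IsContracted t j x then none else some x

section LevelFiltration

variable {t : Fin 9 → Fin 7 × Fin 7} (h : IsLevelled t)

theorem values_levelFiltration :
    (levelFiltration h).values = (fun m : ℕ => (m : ℝ) + 2) '' Set.Iio 3 := by
  ext s
  constructor
  · rintro (⟨x, -, rfl⟩ | ⟨e, -, rfl⟩)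
    · exact ⟨vertexLevel x, Nat.lt_succ_of_le (vertexLevel_le x), rfl⟩
    · exact ⟨edgeLevel e, Nat.lt_succ_of_le (edgeLevel_le e), rfl⟩
  · rintro ⟨m, hm, rfl⟩
    have : ∃ x, vertexLevel x = m := by
      have hm' : m < 3 := hm
      interval_cases m <;> decide
    obtain ⟨x, rfl⟩ := this
    exact Or.inl ⟨x, Set.mem_univ _, rfl⟩

theorem natCast_add_two_injective : Function.Injective fun m : ℕ => (m : ℝ) + 2 := by
  intro a b hab
  simpa using hab

theorem step_levelFiltration {m : ℕ} (hm : m ≤ 2) : (levelFiltration h).step (m + 2) = m := by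
  have : {s ∈ (levelFiltration h).values | s < m + 2} =
      (fun m : ℕ => (m : ℝ) + 2) '' Set.Iio m := by
    ext s
    rw [values_levelFiltration]
    constructor
    · rintro ⟨⟨a, -, rfl⟩, ha⟩
      exact ⟨a, by simpa using ha, rfl⟩
    · rintro ⟨a, ha, rfl⟩
      have ha' : a < m := ha
      exact ⟨⟨a, by change a < 3; omega, rfl⟩, by simpa using ha'⟩
  rw [FiltrationFunction.step, this, Set.ncard_image_of_injective _ natCast_add_two_injective]
  simp [Set.ncard_eq_toFinset_card']

theorem lastStep_levelFiltration : (levelFiltration h).lastStep = 2 := by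
  rw [FiltrationFunction.lastStep, values_levelFiltration,
    Set.ncard_image_of_injective _ natCast_add_two_injective]
  simp [Set.ncard_eq_toFinset_card']

theorem step_onVert (x : Fin 7) :
    (levelFiltration h).step ((levelFiltration h).onVert x) = vertexLevel x :=
  step_levelFiltration h (vertexLevel_le x)

theorem step_onEdge (e : Fin 9) :
    (levelFiltration h).step ((levelFiltration h).onEdge e) = edgeLevel e :=
  step_levelFiltration h (edgeLevel_le e)

theorem mem_icEdges {i : ℕ} {e : Fin 9} : e ∈ (levelFiltration h).icEdges i ↔ edgeLevel e = i := by
  change e ∈ Set.univ ∧ (levelFiltration h).step _ = i ↔ _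
  rw [step_onEdge]
  simp

theorem mem_icVerts {i : ℕ} {x : Fin 7} : x ∈ (levelFiltration h).icVerts i ↔
    vertexLevel x = i ∨ ∃ e, edgeLevel e = i ∧ ((t e).1 = x ∨ (t e).2 = x) := by
  refine or_congr ?_ (exists_congr fun e => and_congr (mem_icEdges h) ⟨?_, ?_⟩)
  · change x ∈ Set.univ ∧ (levelFiltration h).step _ = i ↔ _
    rw [step_onVert]
    simp
  · rintro ⟨y, hy | hy⟩ <;> rw [hy]
    · exact Or.inl rfl
    · exact Or.inr rfl
  · rintro (rfl | rfl)
    · exact ⟨_, Or.inl rfl⟩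
    · exact ⟨_, Or.inr rfl⟩

theorem mem_contractedEdges {j : ℕ} {e : Fin 9} :
    e ∈ (levelFiltration h).contractedEdges j ↔ 2 < edgeLevel e + j := by
  simp only [FiltrationFunction.contractedEdges, Set.mem_ofPred_eq, mem_icEdges,
    lastStep_levelFiltration]
  constructor
  · rintro ⟨i, -, hj, rfl⟩
    exact hj
  · exact fun hj => ⟨_, edgeLevel_le e, hj, rfl⟩

theorem mem_contractedVerts {j : ℕ} {x : Fin 7} :
    x ∈ (levelFiltration h).contractedVerts j ↔ IsContracted t j x := by
  simp only [FiltrationFunction.contractedVerts, Set.mem_ofPred_eq, mem_icVerts,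
    lastStep_levelFiltration]
  constructor
  · rintro ⟨i, -, hj, rfl | ⟨e, rfl, he⟩⟩
    · exact Or.inl hj
    · exact Or.inr ⟨e, hj, he⟩
  · rintro (hj | ⟨e, hj, he⟩)
    · exact ⟨_, vertexLevel_le x, hj, Or.inl rfl⟩
    · exact ⟨_, edgeLevel_le e, hj, Or.inr ⟨e, rfl, he⟩⟩

theorem collapse_contractedVerts (j : ℕ) (x : Fin 7) :
    FiltrationFunction.collapse ((levelFiltration h).contractedVerts j) x = contraction t j x := by
  simp only [FiltrationFunction.collapse, contraction, mem_contractedVerts]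

theorem mem_vertexSet_stage {i j : ℕ} {a : Option (Fin 7)} :
    a ∈ V((levelFiltration h).stage i j) ↔ ∃ x, vertexLevel x ≤ i ∧ contraction t j x = a := by
  rw [FiltrationFunction.mem_stage_vertexSet]
  refine exists_congr fun x => ?_
  rw [step_onVert, collapse_contractedVerts]
  exact and_iff_right (Set.mem_univ x)

theorem isLink_stage {i j : ℕ} {e : Fin 9} {a b : Option (Fin 7)} :
    ((levelFiltration h).stage i j).IsLink e a b ↔ edgeLevel e ≤ i ∧ edgeLevel e + j ≤ 2 ∧
      ((contraction t j (t e).1 = a ∧ contraction t j (t e).2 = b) ∨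
        (contraction t j (t e).1 = b ∧ contraction t j (t e).2 = a)) := by
  simp only [FiltrationFunction.stage_isLink, step_onVert, step_onEdge, mem_contractedEdges,
    collapse_contractedVerts, not_lt]
  have he := h e
  constructor
  · rintro ⟨x, y, hxy | hxy, -, -, h3, h4, rfl, rfl⟩
    · exact ⟨h3, h4, Or.inl (by rw [hxy]; exact ⟨rfl, rfl⟩)⟩
    · exact ⟨h3, h4, Or.inr (by rw [hxy]; exact ⟨rfl, rfl⟩)⟩
  · rintro ⟨h3, h4, ⟨rfl, rfl⟩ | ⟨rfl, rfl⟩⟩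
    · exact ⟨_, _, Or.inl rfl, by omega, by omega, h3, h4, rfl, rfl⟩
    · exact ⟨_, _, Or.inr rfl, by omega, by omega, h3, h4, rfl, rfl⟩

theorem mem_edgeSet_stage {i j : ℕ} {e : Fin 9} :
    e ∈ E((levelFiltration h).stage i j) ↔ edgeLevel e ≤ i ∧ edgeLevel e + j ≤ 2 := by
  constructor
  · intro he
    obtain ⟨a, b, hab⟩ := Graph.exists_isLink_of_mem_edgeSet he
    have := (isLink_stage h).1 hab
    exact ⟨this.1, this.2.1⟩
  · rintro ⟨h1, h2⟩
    exact Graph.IsLink.edge_mem ((isLink_stage h).2 ⟨h1, h2, Or.inl ⟨rfl, rfl⟩⟩)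

theorem contraction_zero (x : Fin 7) : contraction t 0 x = some x := by
  refine if_neg ?_
  rintro (hx | ⟨e, he, -⟩)
  · exact absurd (vertexLevel_le x) (not_le.2 hx)
  · exact absurd (edgeLevel_le e) (not_le.2 he)

theorem contraction_eq_none_or (j : ℕ) (x : Fin 7) :
    contraction t j x = none ∨ contraction t j x = some x := by
  rw [contraction]
  split_ifs <;> simp

theorem isLink_stage_zero {i : ℕ} {e : Fin 9} {x y : Fin 7} :
    ((levelFiltration h).stage i 0).IsLink e (some x) (some y) ↔
      edgeLevel e ≤ i ∧ (t e = (x, y) ∨ t e = (y, x)) := by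
  simp only [isLink_stage, contraction_zero, Option.some.injEq, Prod.ext_iff]
  have := edgeLevel_le e
  constructor
  · rintro ⟨h1, -, h2⟩; exact ⟨h1, h2⟩
  · rintro ⟨h1, h2⟩; exact ⟨h1, this, h2⟩

/-! ### Dimensions of the homology of the stages -/

/-- Each application of `p` stays put or crosses an edge, so `p ∘ p` stays inside components; being
constant on edges, it picks one vertex in each. Two steps are needed because some vertices are not
adjacent to their root. -/
theorem finrank_H₀_sublevel {i : ℕ} {p : Fin 7 → Fin 7}
    (hp : ∀ x, vertexLevel x ≤ i → vertexLevel (p x) ≤ i ∧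
      (p x = x ∨ ∃ e, edgeLevel e ≤ i ∧ (t e = (x, p x) ∨ t e = (p x, x))))
    (hl : ∀ e, edgeLevel e ≤ i → p (p (t e).1) = p (p (t e).2)) :
    Module.finrank (ZMod 2) (H₀ ((levelFiltration h).stage i 0)) =
      ((Finset.univ.filter fun x => vertexLevel x ≤ i).image fun x => p (p x)).card := by
  have hV : ∀ a, a ∈ V((levelFiltration h).stage i 0) ↔ ∃ x, vertexLevel x ≤ i ∧ some x = a := by
    intro a
    simp only [mem_vertexSet_stage, contraction_zero]
  have hstep : ∀ x, vertexLevel x ≤ i →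
      Relation.ReflTransGen ((levelFiltration h).stage i 0).Adj (some x) (some (p x)) := by
    intro x hx
    rcases (hp x hx).2 with h1 | ⟨e, he, h1⟩
    · rw [h1]
    · exact Relation.ReflTransGen.single ⟨e, (isLink_stage_zero h).2 ⟨he, h1⟩⟩
  rw [finrank_H₀_eq_ncard (r := Option.map fun x => p (p x))]
  · rw [← Set.ncard_coe_finset]
    refine Eq.trans ?_ (Set.ncard_image_of_injective _ (Option.some_injective _))
    refine congrArg Set.ncard (Set.ext fun a => ?_)
    constructor
    · rintro ⟨b, hb, rfl⟩
      obtain ⟨x, hx, rfl⟩ := (hV _).1 hb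
      exact ⟨p (p x), by simpa using ⟨x, hx, rfl⟩, rfl⟩
    · rintro ⟨y, hy, rfl⟩
      obtain ⟨x, hx, rfl⟩ : ∃ x, vertexLevel x ≤ i ∧ p (p x) = y := by simpa using hy
      exact ⟨some x, (hV _).2 ⟨x, hx, rfl⟩, rfl⟩
  · intro a ha
    obtain ⟨x, hx, rfl⟩ := (hV _).1 ha
    exact (hV _).2 ⟨p (p x), (hp _ (hp x hx).1).1, rfl⟩
  · intro e a b hab
    obtain ⟨x, hx, rfl⟩ := (hV _).1 hab.left_mem
    obtain ⟨y, hy, rfl⟩ := (hV _).1 hab.right_mem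
    obtain ⟨he, hxy | hxy⟩ := (isLink_stage_zero h).1 hab
    · have := hl e he
      rw [hxy] at this
      exact congrArg some this
    · have := hl e he
      rw [hxy] at this
      exact congrArg some this.symm
  · intro a ha
    obtain ⟨x, hx, rfl⟩ := (hV _).1 ha
    exact (hstep x hx).trans (hstep _ (hp x hx).1)

/-- Every vertex of the quotient is the collapsed point or adjacent to it, so the quotient is
connected. -/
theorem finrank_H₀_quotient {j : ℕ} (h0 : ∃ x, contraction t j x = none)
    (h1 : ∀ x, contraction t j x = none ∨ ∃ e, edgeLevel e + j ≤ 2 ∧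
      (((t e).1 = x ∧ contraction t j (t e).2 = none) ∨
        ((t e).2 = x ∧ contraction t j (t e).1 = none))) :
    Module.finrank (ZMod 2) (H₀ ((levelFiltration h).stage 2 j)) = 1 := by
  obtain ⟨z, hz⟩ := h0
  have hn : none ∈ V((levelFiltration h).stage 2 j) :=
    (mem_vertexSet_stage h).2 ⟨z, vertexLevel_le z, hz⟩
  rw [finrank_H₀_eq_ncard (r := fun _ => none) (fun _ _ => hn) (fun _ _ _ _ => rfl),
    Set.Nonempty.image_const ⟨_, hn⟩, Set.ncard_singleton]
  intro a ha
  obtain ⟨x, hx, rfl⟩ := (mem_vertexSet_stage h).1 ha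
  rcases h1 x with hx | ⟨e, he, ⟨rfl, hy⟩ | ⟨rfl, hy⟩⟩
  · rw [hx]
  · exact Relation.ReflTransGen.single
      ⟨e, (isLink_stage h).2 ⟨edgeLevel_le e, he, Or.inl ⟨rfl, hy⟩⟩⟩
  · exact Relation.ReflTransGen.single
      ⟨e, (isLink_stage h).2 ⟨edgeLevel_le e, he, Or.inr ⟨hy, rfl⟩⟩⟩

theorem ncard_vertexSet_quotient (j : ℕ) : V((levelFiltration h).stage 2 j).ncard =
    (Finset.univ.image (contraction t j)).card := by
  rw [← Set.ncard_coe_finset]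
  congr 1
  ext a
  rw [mem_vertexSet_stage]
  simp [vertexLevel_le]

/-! ### Structure maps of the forward and the backward sequence -/

theorem onH₀_forward_surjective {i : ℕ} (hi : ∀ y, vertexLevel y ≤ i + 1 → ∃ x, vertexLevel x ≤ i ∧
    (x = y ∨ ∃ e, edgeLevel e ≤ i + 1 ∧ (t e = (x, y) ∨ t e = (y, x)))) :
    Function.Surjective ((levelFiltration h).stageMap i.le_succ (le_refl 0)).onH₀ := by
  refine CellMap.onH₀_surjective _ fun b hb => ?_
  obtain ⟨y, hy, rfl⟩ := (mem_vertexSet_stage h).1 hb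
  obtain ⟨x, hx, hxy⟩ := hi y hy
  have hmap : ((levelFiltration h).stageMap i.le_succ (le_refl 0)).onVert (some x) = some x := by
    change FiltrationFunction.collapse _ x = _
    rw [collapse_contractedVerts, contraction_zero]
  refine ⟨some x, (mem_vertexSet_stage h).2 ⟨x, hx, contraction_zero x⟩, ?_⟩
  rw [hmap, contraction_zero]
  rcases hxy with rfl | ⟨e, he⟩
  · exact Or.inl rfl
  · exact Or.inr ⟨e, (isLink_stage_zero h).2 he⟩

theorem onH₁_forward_injective (i : ℕ) :
    Function.Injective ((levelFiltration h).stageMap i.le_succ (le_refl 0)).onH₁ := by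
  refine CellMap.onH₁_injective _ fun e he => ?_
  rw [mem_edgeSet_stage] at he ⊢
  exact ⟨he.1.trans i.le_succ, he.2⟩

theorem stageMap_onVert_contraction {i i' j j' : ℕ} (hi : i ≤ i') (hj : j ≤ j') (x : Fin 7) :
    ((levelFiltration h).stageMap hi hj).onVert (contraction t j x) = contraction t j' x := by
  rw [← collapse_contractedVerts h, ← collapse_contractedVerts h]
  exact (levelFiltration h).bind_collapse hj x

theorem onH₀_backward_surjective {i : ℕ} (j : ℕ) :
    Function.Surjective ((levelFiltration h).stageMap (le_refl i) j.le_succ).onH₀ := by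
  refine CellMap.onH₀_surjective _ fun b hb => ?_
  obtain ⟨x, hx, rfl⟩ := (mem_vertexSet_stage h).1 hb
  exact ⟨_, (mem_vertexSet_stage h).2 ⟨x, hx, rfl⟩,
    Or.inl (stageMap_onVert_contraction h _ _ x)⟩

/-- The hypothesis says that the part collapsed at this step contains a star centred at `root` that
reaches all its vertices. Such a connected part lets every cycle of the quotient be closed up before
the collapse. -/
theorem onH₁_backward_surjective {j : ℕ} {root : Option (Fin 7)}
    (hroot : ∀ x, contraction t (j + 1) x = none → contraction t j x = root ∨
      ∃ e, edgeLevel e + j ≤ 2 ∧ 2 < edgeLevel e + (j + 1) ∧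
        (((t e).1 = x ∧ contraction t j (t e).2 = root) ∨
          ((t e).2 = x ∧ contraction t j (t e).1 = root))) :
    Function.Surjective ((levelFiltration h).stageMap (le_refl 2) j.le_succ).onH₁ := by
  refine CellMap.onH₁_surjective _ (fun e he => ?_)
    (s := fun b => b.elim root some) fun a ha => ?_
  · rw [mem_edgeSet_stage] at he ⊢
    exact ⟨he.1, by omega⟩
  · obtain ⟨x, -, rfl⟩ := (mem_vertexSet_stage h).1 ha
    rw [stageMap_onVert_contraction]
    have hedge : ∀ e, 2 < edgeLevel e + (j + 1) → e ∉ E((levelFiltration h).stage 2 j.succ) :=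
      fun e he he' => absurd ((mem_edgeSet_stage h).1 he').2 (not_le.2 he)
    by_cases hx : contraction t (j + 1) x = none
    · rw [hx]
      rcases hroot x hx with h1 | ⟨e, he, he', ⟨rfl, h2⟩ | ⟨rfl, h2⟩⟩
      · simp [h1]
      · exact single_sub_single_mem_of_isLink _ ((isLink_stage h).2
          ⟨edgeLevel_le e, he, Or.inl ⟨rfl, h2⟩⟩) (hedge e he')
      · exact single_sub_single_mem_of_isLink _ ((isLink_stage h).2
          ⟨edgeLevel_le e, he, Or.inr ⟨h2, rfl⟩⟩) (hedge e he')
    · have h1 := (contraction_eq_none_or (t := t) (j + 1) x).resolve_left hx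
      have h2 : contraction t j x = some x := by
        rcases contraction_eq_none_or (t := t) j x with h2 | h2
        -- The collapsed point stays collapsed, so a vertex that survives step `j + 1` had survived
        -- step `j`.
        · have := stageMap_onVert_contraction h (le_refl 2) j.le_succ x
          rw [h2] at this
          exact absurd (this.trans h1) (by simp [FiltrationFunction.stageMap])
        · exact h2
      rw [h1, h2]
      simp

end LevelFiltration

/-! ### The class of graphs containing the two examples -/

/-- Conditions under which the forward and the backward diagrams of the level filtration do not
depend on the graph. The map `p i` moves every vertex towards a root of its component in the
`i`-th sublevel graph, which is reached in two steps. -/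
structure IsBalanced (t : Fin 9 → Fin 7 × Fin 7) (p : Fin 3 → Fin 7 → Fin 7) : Prop where
  levelled : IsLevelled t
  not_loop : ∀ e, (t e).1 ≠ (t e).2
  not_parallel : ∀ e e', t e = t e' ∨ t e = (t e').swap → e = e'
  degree : ∀ x, (Finset.univ.filter fun e => (t e).1 = x ∨ (t e).2 = x).card = vertexLevel x + 2
  retract : ∀ (i : Fin 3) (x), vertexLevel x ≤ i → vertexLevel (p i x) ≤ i ∧
    (p i x = x ∨ ∃ e, edgeLevel e ≤ i ∧ (t e = (x, p i x) ∨ t e = (p i x, x)))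
  components : ∀ (i : Fin 3) (e), edgeLevel e ≤ i → p i (p i (t e).1) = p i (p i (t e).2)
  card_components : ∀ i : Fin 3, ((Finset.univ.filter fun x => vertexLevel x ≤ i).image
    fun x => p i (p i x)).card = 3 - i
  growth : ∀ (i : Fin 2) (y), vertexLevel y ≤ i + 1 → ∃ x, vertexLevel x ≤ i ∧
    (x = y ∨ ∃ e, edgeLevel e ≤ i + 1 ∧ (t e = (x, y) ∨ t e = (y, x)))
  collapsed : ∀ j : Fin 3, ∃ x, contraction t (j + 1) x = none
  quotient : ∀ (j : Fin 3) (x), contraction t (j + 1) x = none ∨ ∃ e, edgeLevel e + (j + 1) ≤ 2 ∧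
    (((t e).1 = x ∧ contraction t (j + 1) (t e).2 = none) ∨
      ((t e).2 = x ∧ contraction t (j + 1) (t e).1 = none))
  card_quotient : ∀ j : Fin 4, (Finset.univ.image (contraction t j)).card =
    (![7, 3, 1, 1] : Fin 4 → ℕ) j
  root : ∀ j : Fin 3, ∃ root, ∀ x, contraction t (j + 1) x = none → contraction t j x = root ∨
    ∃ e, edgeLevel e + j ≤ 2 ∧ 2 < edgeLevel e + (j + 1) ∧
      (((t e).1 = x ∧ contraction t j (t e).2 = root) ∨
        ((t e).2 = x ∧ contraction t j (t e).1 = root))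

theorem values_levelFiltration_finite {t : Fin 9 → Fin 7 × Fin 7} (h : IsLevelled t) :
    (levelFiltration h).values.Finite :=
  (levelFiltration h).values_finite (Set.toFinite _) (Set.toFinite _)

theorem stage_levelFiltration_eq {t : Fin 9 → Fin 7 × Fin 7} (h : IsLevelled t) (i j : ℕ) :
    (levelFiltration h).stage i j = (levelFiltration h).stage (min i 2) (min j 3) := by
  apply (levelFiltration h).stage_eq (values_levelFiltration_finite h) <;>
    rw [lastStep_levelFiltration] <;> omega

theorem finite_pathSequence_levelFiltration {t : Fin 9 → Fin 7 × Fin 7} (h : IsLevelled t)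
    {a b : ℕ → ℕ} (ha : Monotone a) (hb : Monotone b) (k i : ℕ) :
    Finite ((((levelFiltration h).pathSequence ha hb).persistentHomology k).space i) :=
  GraphSequence.finite_persistentHomology (fun _ => Set.toFinite _) (fun _ => Set.toFinite _) k i

namespace IsBalanced

variable {t t' : Fin 9 → Fin 7 × Fin 7} {p p' : Fin 3 → Fin 7 → Fin 7}

theorem simple (b : IsBalanced t p) : (ofEnds t).Simple where
  not_isLoopAt e x hx := by
    rcases hx with hx | hx <;> exact b.not_loop e (by rw [hx])
  eq_of_isLink e e' x y he he' := by
    refine b.not_parallel e e' ?_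
    rcases he with he | he <;> rcases he' with he' | he' <;> simp [he, he']

theorem isDegreeFiltration (b : IsBalanced t p) :
    (levelFiltration b.levelled).IsDegreeFiltration := by
  refine ⟨fun x _ => ?_, fun e x y hxy => ?_⟩
  · have h1 : (ofEnds t).incidenceSet x =
        ↑(Finset.univ.filter fun e => (t e).1 = x ∨ (t e).2 = x) := by
      ext e
      simp only [Graph.mem_incidenceSet, Finset.coe_filter, Finset.mem_univ, true_and,
        Set.mem_ofPred_eq]
      constructor
      · rintro ⟨y, hy | hy⟩ <;> rw [hy]
        · exact Or.inl rfl
        · exact Or.inr rfl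
      · rintro (rfl | rfl)
        · exact ⟨_, Or.inl rfl⟩
        · exact ⟨_, Or.inr rfl⟩
    have h2 : (ofEnds t).loopSet x = ∅ :=
      Set.eq_empty_of_forall_notMem fun e he => b.simple.not_isLoopAt e x he
    rw [GraphPersistence.degree, h1, h2, Set.ncard_coe_finset, b.degree]
    simp [levelFiltration]
  · change (edgeLevel e : ℝ) + 2 = max ((vertexLevel x : ℝ) + 2) ((vertexLevel y : ℝ) + 2)
    rw [b.levelled e, max_add_add_right, Nat.cast_max]
    rcases hxy with hxy | hxy <;> rw [hxy]
    rw [max_comm]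

theorem finrank_H₀_forward (b : IsBalanced t p) (i : ℕ) :
    Module.finrank (ZMod 2) (H₀ ((levelFiltration b.levelled).stage i 0)) = 3 - min i 2 := by
  rw [stage_levelFiltration_eq]
  obtain ⟨m, hm⟩ : ∃ m : Fin 3, (m : ℕ) = min i 2 := ⟨⟨min i 2, by omega⟩, rfl⟩
  rw [← hm]
  exact (finrank_H₀_sublevel b.levelled (b.retract m) (b.components m)).trans (b.card_components m)

theorem finrank_H₀_backward (b : IsBalanced t p) (j : ℕ) :
    Module.finrank (ZMod 2) (H₀ ((levelFiltration b.levelled).stage 2 j)) = 1 := by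
  obtain _ | j := j
  · exact b.finrank_H₀_forward 2
  · rw [stage_levelFiltration_eq]
    obtain ⟨m, hm⟩ : ∃ m : Fin 3, (m : ℕ) + 1 = min (j + 1) 3 := ⟨⟨min j 2, by omega⟩, by change min j 2 + 1 = _; omega⟩
    rw [← hm]
    exact finrank_H₀_quotient b.levelled (b.collapsed m) (b.quotient m)

theorem edgeSet_stage_eq (b : IsBalanced t p) (b' : IsBalanced t' p') (i j : ℕ) :
    E((levelFiltration b.levelled).stage i j) = E((levelFiltration b'.levelled).stage i j) := by
  ext e
  rw [mem_edgeSet_stage, mem_edgeSet_stage]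

theorem vertexSet_forward_eq (b : IsBalanced t p) (b' : IsBalanced t' p') (i : ℕ) :
    V((levelFiltration b.levelled).stage i 0) = V((levelFiltration b'.levelled).stage i 0) := by
  ext a
  simp only [mem_vertexSet_stage, contraction_zero]

theorem ncard_vertexSet_backward_eq (b : IsBalanced t p) (b' : IsBalanced t' p') (j : ℕ) :
    V((levelFiltration b.levelled).stage 2 j).ncard =
      V((levelFiltration b'.levelled).stage 2 j).ncard := by
  rw [stage_levelFiltration_eq, stage_levelFiltration_eq b'.levelled]
  obtain ⟨m, hm⟩ : ∃ m : Fin 4, (m : ℕ) = min j 3 := ⟨⟨min j 3, by omega⟩, rfl⟩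
  rw [← hm, min_self, ncard_vertexSet_quotient, ncard_vertexSet_quotient, b.card_quotient,
    b'.card_quotient]

/-- By the Euler characteristic, the numbers of vertices, edges and components determine the first
Betti number. -/
theorem finrank_H₁_eq {h : IsLevelled t} {h' : IsLevelled t'} {i j : ℕ}
    (hV : V((levelFiltration h).stage i j).ncard = V((levelFiltration h').stage i j).ncard)
    (hE : E((levelFiltration h).stage i j) = E((levelFiltration h').stage i j))
    (h₀ : Module.finrank (ZMod 2) (H₀ ((levelFiltration h).stage i j)) =
      Module.finrank (ZMod 2) (H₀ ((levelFiltration h').stage i j))) :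
    Module.finrank (ZMod 2) (H₁ ((levelFiltration h).stage i j)) =
      Module.finrank (ZMod 2) (H₁ ((levelFiltration h').stage i j)) := by
  have h1 := finrank_H₁_add_ncard (X := (levelFiltration h).stage i j)
    (Set.toFinite _) (Set.toFinite _)
  have h2 := finrank_H₁_add_ncard (X := (levelFiltration h').stage i j)
    (Set.toFinite _) (Set.toFinite _)
  rw [hV, hE, h₀] at h1
  omega

theorem surjective_forward_of_le (h : IsLevelled t) (k : ℕ) {i : ℕ} (hi : 2 ≤ i) :
    Function.Surjective (((levelFiltration h).forward.persistentHomology k).map i) :=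
  (levelFiltration h).surjective_pathSequence_map (values_levelFiltration_finite h)
    monotone_id (monotone_const (c := 0)) (by rwa [lastStep_levelFiltration]) (Or.inl rfl) k

theorem surjective_H₀_forward (b : IsBalanced t p) (i : ℕ) :
    Function.Surjective (((levelFiltration b.levelled).forward.persistentHomology 0).map i) := by
  rcases lt_or_ge i 2 with hi | hi
  · exact onH₀_forward_surjective b.levelled (b.growth ⟨i, hi⟩)
  · exact surjective_forward_of_le b.levelled 0 hi

theorem exists_common_forward_diagram (b : IsBalanced t p) (b' : IsBalanced t' p') (k : ℕ) :
    ∃ D, IsPersistenceDiagram ((levelFiltration b.levelled).forward.persistentHomology k) D ∧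
      IsPersistenceDiagram ((levelFiltration b'.levelled).forward.persistentHomology k) D := by
  have : ∀ i, Finite (((levelFiltration b.levelled).forward.persistentHomology k).space i) :=
    finite_pathSequence_levelFiltration b.levelled monotone_id monotone_const k
  have : ∀ i, Finite (((levelFiltration b'.levelled).forward.persistentHomology k).space i) :=
    finite_pathSequence_levelFiltration b'.levelled monotone_id monotone_const k
  match k with
  | 0 =>
    exact PersistenceModule.exists_common_diagram_of_surjective b.surjective_H₀_forward
      b'.surjective_H₀_forward fun i =>
        (b.finrank_H₀_forward i).trans (b'.finrank_H₀_forward i).symm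
  | 1 =>
    exact PersistenceModule.exists_common_diagram_of_injective (T := 2)
      (fun i => surjective_forward_of_le b.levelled 1)
      (fun i => surjective_forward_of_le b'.levelled 1)
      (onH₁_forward_injective b.levelled) (onH₁_forward_injective b'.levelled) fun i =>
        finrank_H₁_eq (congrArg Set.ncard (b.vertexSet_forward_eq b' i))
          (b.edgeSet_stage_eq b' i 0)
          ((b.finrank_H₀_forward i).trans (b'.finrank_H₀_forward i).symm)
  | k + 2 => exact GraphSequence.exists_common_diagram_of_two_le _ _ k

/-- The backward sequence of a level filtration, with the number of steps made explicit. -/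
theorem backward_levelFiltration (h : IsLevelled t) : (levelFiltration h).backward =
    (levelFiltration h).pathSequence (monotone_const (c := 2)) monotone_id := by
  rw [FiltrationFunction.backward_eq]
  congr 1
  rw [lastStep_levelFiltration]

theorem surjective_H₁_backward (b : IsBalanced t p) (j : ℕ) :
    Function.Surjective ((((levelFiltration b.levelled).pathSequence
      (monotone_const (c := 2)) monotone_id).persistentHomology 1).map j) := by
  rcases lt_or_ge j 3 with hj | hj
  · obtain ⟨root, hroot⟩ := b.root ⟨j, hj⟩
    exact onH₁_backward_surjective b.levelled hroot
  · exact (levelFiltration b.levelled).surjective_pathSequence_map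
      (values_levelFiltration_finite b.levelled) monotone_const monotone_id
      (by rw [lastStep_levelFiltration])
      (Or.inr (by rw [lastStep_levelFiltration]; exact hj)) 1

theorem exists_common_backward_diagram (b : IsBalanced t p) (b' : IsBalanced t' p') (k : ℕ) :
    ∃ D, IsPersistenceDiagram ((levelFiltration b.levelled).backward.persistentHomology k) D ∧
      IsPersistenceDiagram ((levelFiltration b'.levelled).backward.persistentHomology k) D := by
  rw [backward_levelFiltration, backward_levelFiltration]
  have := finite_pathSequence_levelFiltration b.levelled (monotone_const (c := 2)) monotone_id k
  have := finite_pathSequence_levelFiltration b'.levelled (monotone_const (c := 2)) monotone_id k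
  match k with
  | 0 =>
    exact PersistenceModule.exists_common_diagram_of_surjective
      (onH₀_backward_surjective b.levelled) (onH₀_backward_surjective b'.levelled) fun j =>
        (b.finrank_H₀_backward j).trans (b'.finrank_H₀_backward j).symm
  | 1 =>
    exact PersistenceModule.exists_common_diagram_of_surjective
      b.surjective_H₁_backward b'.surjective_H₁_backward fun j =>
        finrank_H₁_eq (b.ncard_vertexSet_backward_eq b' j) (b.edgeSet_stage_eq b' 2 j)
          ((b.finrank_H₀_backward j).trans (b'.finrank_H₀_backward j).symm)
  | k + 2 => exact GraphSequence.exists_common_diagram_of_two_le _ _ k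

end IsBalanced

/-- The number of forward-backward classes that are born before `G/IC₂` and survive the
contraction of `IC₂ ∪ IC₁`. -/
theorem countP_forwardBackward_levelFiltration {t : Fin 9 → Fin 7 × Fin 7} (h : IsLevelled t)
    {D : Diagram}
    (hD : IsPersistenceDiagram ((levelFiltration h).forwardBackward.persistentHomology 1) D) :
    D.countP (fun p => p.1 ≤ 1 ∧ ((4 : ℕ) : ℕ∞) < p.2) =
      ((levelFiltration h).stageMap (show 1 ≤ 2 by omega) (Nat.zero_le 2)).homologyRank 1 := by
  rw [hD.countP_eq_rank (by omega), FiltrationFunction.forwardBackward_eq,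
    FiltrationFunction.rank_pathSequence _ _ _ (show 1 ≤ 4 by omega)]
  -- With `n = 2`, time `1` is stage `(1, 0)`, and time `4` is stage `(4, 2)`, which is the same
  -- graph as `(2, 2)`.
  apply (levelFiltration h).homologyRank_stageMap_congr (values_levelFiltration_finite h) <;>
    rw [lastStep_levelFiltration] <;> rfl

/-! ### The two examples -/

/-- The ends of the edges of the first graph. -/
def ends₁ : Fin 9 → Fin 7 × Fin 7 :=
  ![(3, 5), (0, 3), (0, 5), (1, 4), (2, 4), (0, 6), (1, 6), (2, 6), (4, 6)]

/-- The ends of the edges of the second graph. -/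
def ends₂ : Fin 9 → Fin 7 × Fin 7 :=
  ![(1, 5), (0, 3), (0, 4), (3, 4), (2, 4), (0, 6), (1, 6), (2, 6), (5, 6)]

/-- Here `G₁` consists of the triangle `0, 3, 5` and the path `1, 4, 2`; vertex `6` then joins them.
The rows are the parent maps for the sublevels `0`, `1`, `2`. -/
theorem isBalanced_ends₁ : IsBalanced ends₁
    ![![0, 1, 2, 3, 4, 3, 6], ![0, 4, 4, 0, 4, 0, 6], ![6, 6, 6, 0, 6, 0, 6]] where
  levelled := by unfold IsLevelled; decide
  not_loop := by decide
  not_parallel := by decide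
  degree := by decide
  retract := by decide
  components := by decide
  card_components := by decide
  growth := by decide
  collapsed := by decide
  quotient := by decide
  card_quotient := by decide
  root := by decide

/-- Here `G₁` consists of the triangle `0, 3, 4` with the pendant vertex `2`, and the separate edge
from `1` to `5`. -/
theorem isBalanced_ends₂ : IsBalanced ends₂
    ![![0, 1, 2, 3, 4, 1, 6], ![4, 1, 4, 4, 4, 1, 6], ![6, 6, 6, 0, 0, 6, 6]] where
  levelled := by unfold IsLevelled; decide
  not_loop := by decide
  not_parallel := by decide
  degree := by decide
  retract := by decide
  components := by decide
  card_components := by decide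
  growth := by decide
  collapsed := by decide
  quotient := by decide
  card_quotient := by decide
  root := by decide

/-- In the first graph, the triangle with vertices `0, 3, 5` survives the contraction. -/
theorem homologyRank_ends₁_ne_zero : ((levelFiltration isBalanced_ends₁.levelled).stageMap
    (show 1 ≤ 2 by omega) (Nat.zero_le 2)).homologyRank 1 ≠ 0 := by
  have l₀ := (isLink_stage_zero isBalanced_ends₁.levelled (i := 1) (e := 0) (x := 3) (y := 5)).2
    (by decide)
  have l₁ := (isLink_stage_zero isBalanced_ends₁.levelled (i := 1) (e := 1) (x := 0) (y := 3)).2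
    (by decide)
  have l₂ := (isLink_stage_zero isBalanced_ends₁.levelled (i := 1) (e := 2) (x := 5) (y := 0)).2
    (by decide)
  refine CellMap.homologyRank_one_ne_zero _ (Set.toFinite _)
    (c := Finsupp.single 0 1 + Finsupp.single 1 1 + Finsupp.single 2 1) ⟨?_, ?_⟩
    ((mem_edgeSet_stage _ (e := 0)).2 (by decide)) (by simp)
  · exact add_mem (add_mem (single_mem_chains₁ l₀.edge_mem) (single_mem_chains₁ l₁.edge_mem))
      (single_mem_chains₁ l₂.edge_mem)
  · change boundary _ _ = 0
    rw [map_add, map_add, boundary_single, boundary_single, boundary_single,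
      edgeBoundary_eq_sub l₀, edgeBoundary_eq_sub l₁, edgeBoundary_eq_sub l₂]
    abel

/-- In the second graph, all cycles of the sublevel graph consist of contracted edges. -/
theorem homologyRank_ends₂_eq_zero : ((levelFiltration isBalanced_ends₂.levelled).stageMap
    (show 1 ≤ 2 by omega) (Nat.zero_le 2)).homologyRank 1 = 0 := by
  refine CellMap.homologyRank_one_eq_zero _ fun c hc e he => ?_
  -- After two contractions only edges of level `0` remain, and there is just one.
  have key : ∀ e, edgeLevel e + 2 ≤ 2 → e = 0 := by decide
  obtain rfl := key e ((mem_edgeSet_stage _).1 he).2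
  -- Vertex `5` has degree one in `G₁`: its other edge goes to vertex `6` and has level `2`.
  have l := (isLink_stage_zero isBalanced_ends₂.levelled (i := 1) (e := 0) (x := 5) (y := 1)).2
    (by decide)
  refine eq_zero_of_mem_cycles₁ hc l (by decide) fun e' he' => ?_
  obtain ⟨y, hy⟩ := he'
  obtain ⟨x, -, rfl⟩ := (mem_vertexSet_stage _).1 hy.right_mem
  rw [contraction_zero, isLink_stage_zero] at hy
  revert e' x
  decide

end GraphPersistence

theorem mainTheorem1 :
    -- FB diagrams determine the forward and the backward diagrams
    (∃ Φ Ψ : ℕ → Diagram → Diagram,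
      ∀ (α β : Type u) (G : Graph α β) (f : FiltrationFunction G),
        V(G).Finite → E(G).Finite → ∀ k : ℕ,
          ∃ D, IsPersistenceDiagram (f.forwardBackward.persistentHomology k) D ∧
            IsPersistenceDiagram (f.forward.persistentHomology k) (Φ f.lastStep D) ∧
            IsPersistenceDiagram (f.backward.persistentHomology k) (Ψ f.lastStep D)) ∧
    -- two graphs with equal forward and equal backward diagrams, but different FB diagrams
    (∃ (α β : Type) (_ : Finite α) (_ : Finite β) (G H : Graph α β)
        (f : FiltrationFunction G) (g : FiltrationFunction H),
      G.Simple ∧ H.Simple ∧ f.IsDegreeFiltration ∧ g.IsDegreeFiltration ∧ f.values = g.values ∧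
      (∀ k : ℕ, ∃ D, IsPersistenceDiagram (f.forward.persistentHomology k) D ∧
        IsPersistenceDiagram (g.forward.persistentHomology k) D) ∧
      (∀ k : ℕ, ∃ D, IsPersistenceDiagram (f.backward.persistentHomology k) D ∧
        IsPersistenceDiagram (g.backward.persistentHomology k) D) ∧
      ∃ k D D', IsPersistenceDiagram (f.forwardBackward.persistentHomology k) D ∧
        IsPersistenceDiagram (g.forwardBackward.persistentHomology k) D' ∧ D ≠ D') := by
  refine ⟨⟨Diagram.truncate, Diagram.shift, fun α β G f hV hE k => ?_⟩,
    Fin 7, Fin 9, inferInstance, inferInstance, ofEnds ends₁, ofEnds ends₂,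
    levelFiltration isBalanced_ends₁.levelled, levelFiltration isBalanced_ends₂.levelled,
    isBalanced_ends₁.simple, isBalanced_ends₂.simple, isBalanced_ends₁.isDegreeFiltration,
    isBalanced_ends₂.isDegreeFiltration, ?_,
    isBalanced_ends₁.exists_common_forward_diagram isBalanced_ends₂,
    isBalanced_ends₁.exists_common_backward_diagram isBalanced_ends₂, 1, ?_⟩
  · obtain ⟨D, hD⟩ := f.exists_isPersistenceDiagram_forwardBackward hV hE k
    exact ⟨D, hD, f.isPersistenceDiagram_forward hV hE hD, f.isPersistenceDiagram_backward hV hE hD⟩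
  · rw [values_levelFiltration, values_levelFiltration]
  · obtain ⟨D, hD⟩ := (levelFiltration isBalanced_ends₁.levelled
      ).exists_isPersistenceDiagram_forwardBackward (Set.toFinite _) (Set.toFinite _) 1
    obtain ⟨D', hD'⟩ := (levelFiltration isBalanced_ends₂.levelled
      ).exists_isPersistenceDiagram_forwardBackward (Set.toFinite _) (Set.toFinite _) 1
    refine ⟨D, D', hD, hD', ?_⟩
    -- A common diagram would have a single count of bars born by time `1` and alive at time `4`,
    -- whereas this count is nonzero for the first graph and zero for the second.
    rintro rfl
    apply homologyRank_ends₁_ne_zero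
    rw [← countP_forwardBackward_levelFiltration _ hD,
      countP_forwardBackward_levelFiltration _ hD', homologyRank_ends₂_eq_zero]
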